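/- Let $2\le n_1\le n_2$ be integers, $\delta\in(0,2)$, $p\in(0,1/2)$, and let $\eta_1\in\{\pm1\}^{n_1}$, $\eta_2\in\{\pm1\}^{n_2}$ be label vectors. Let $A$ be an $n_1\times n_2$ random matrix drawn from the bipartite stochastic block model with these parameters: the entries $A_{ij}$ are independent, $A_{ij}$ is Bernoulli with parameter $\delta p$ if $\eta_{1i}=\eta_{2j}$, and Bernoulli with parameter $(2-\delta)p$ if $\eta_{1i}\neq\eta_{2j}$. Let $W=A-\mathbb{E}(A)$ be the noise matrix, with columns $W_1,\dots,W_{n_2}$; for a matrix $M\in\mathbb{R}^{n_1\times n_1}$ let $H(M)=M-\mathrm{diag}(M)$, where $\mathrm{diag}(M)$ is the diagonal matrix with the same diagonal as $M$, and let $\|M\|_\infty$ denote the spectral norm of $M$. Then, for all $t\ge 0$, $$\mathbb{P}\left(\Big\|\sum_{j=1}^{n_2}H(W_jW_j^\top)\Big\|_\infty\ge t\right)\le n_1\exp\left(-\frac{t^2}{8n_1n_2p^2+6(1+2n_1p)t}\right).$$ -/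

import Mathlib

namespace BSBM

open MeasureTheory ProbabilityTheory

/-- The connection probability of two vertices with labels `s` and `s'`: `δ p` if the labels agree
and `(2 - δ) p` otherwise. -/
noncomputable def edgeProb (δ p : ℝ) (s s' : ℤˣ) : ℝ :=
  if s = s' then δ * p else (2 - δ) * p

/-- The random biadjacency matrix `A` is drawn from the bipartite stochastic block model with
parameters `δ`, `p` and label vectors `η₁` of `V₁`, `η₂` of `V₂` (labels in `ℤˣ = {1, -1}`): the
entries of `A` are independent and `A i j` has the Bernoulli law (on the values `1` and `0`) with
the parameter given by `edgeProb`. -/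
structure IsBSBM {Ω : Type*} [MeasurableSpace Ω] (μ : Measure Ω) {n₁ n₂ : ℕ} (δ p : ℝ)
    (η₁ : Fin n₁ → ℤˣ) (η₂ : Fin n₂ → ℤˣ) (A : Ω → Matrix (Fin n₁) (Fin n₂) ℝ) : Prop where
  indep : iIndepFun (fun (ij : Fin n₁ × Fin n₂) (ω : Ω) => A ω ij.1 ij.2) μ
  law : ∀ (i : Fin n₁) (j : Fin n₂), ∃ q : unitInterval, (q : ℝ) = edgeProb δ p (η₁ i) (η₂ j) ∧
    HasLaw (fun ω => A ω i j) (bernoulliMeasure (1 : ℝ) 0 q) μ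

/-- The noise matrix `W = A - 𝔼 A`, the expectation being taken entrywise. -/
noncomputable def noise {Ω : Type*} [MeasurableSpace Ω] (μ : Measure Ω) {n₁ n₂ : ℕ}
    (A : Ω → Matrix (Fin n₁) (Fin n₂) ℝ) (ω : Ω) : Matrix (Fin n₁) (Fin n₂) ℝ :=
  A ω - Matrix.of fun i j => ∫ ω', A ω' i j ∂μ

/-- The hollowing operator `H(M) = M - diag(M)`. -/
def hollow {n : ℕ} (M : Matrix (Fin n) (Fin n) ℝ) : Matrix (Fin n) (Fin n) ℝ :=
  M - Matrix.diagonal M.diag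

/-- The spectral norm of a square matrix: its operator norm on Euclidean space. -/
noncomputable def spectralNorm {n : ℕ} (M : Matrix (Fin n) (Fin n) ℝ) : ℝ :=
  ‖Matrix.toEuclideanCLM (n := Fin n) (𝕜 := ℝ) M‖

end BSBM

namespace BSBM

open Matrix Filter Topology

/-! ### Trace inequalities for powers of products of symmetric matrices. -/

section TraceInequalities

variable {ι : Type*} [Fintype ι]

/-! The proof is a Laplace transform argument in which independent columns are added one at a time.
A single trace exponential with ordinary Golden–Thompson would give a second-order growth rate of
about `n/2` and, after treating both signs, a prefactor `2n`. Both losses are recovered by a finer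
bound, tr exp(Y+Z) ≤ tr (e^(Y/2) e^(Z/2))², the level `k = 1` of `trace_exp_add_le`. With M =
e^(Y/2), its quadratic terms are tr(M²Z²)/4 and tr(MZMZ)/4. For a hollow Gram matrix Z of a centred
independent column, the mean of tr(MZMZ) involves (tr M)² and tr M², and (tr M)² is much smaller
than n tr M² once the trace is carried by few eigenvalues.

This produces a closed linear system for the means of tr e^Y and (tr e^(Y/2))². Its solution,
normalised to start at 1, is `traceMajorant` and `sqTraceMajorant`, whose dominant rate is only
about `n/4`. Cubic and higher terms cost a factor exp(d) per column (`colExp_third_order_le`), so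
the outcome is `multiExp_trace_exp_le`.

Write E for the exponent in the claim. If E < log n the bound exceeds 1, so let E ≥ log n. Markov's
inequality is applied to the trace of cosh(θX) − 1, which covers both signs, with θt = 3E instead of
the customary 2E. The halved rate makes the majorant grow like exp((9/8)E) up to lower-order terms,
well below exp(2E)/2, and this room pays for the factor 2. The remaining scalar inequality is
`traceMajorant_sub_one_le`. The third-order factor fits into the part of the exponent that the
linear term in t leaves free (`exp_mul_traceMajorant_le`). -/

theorem trace_mul_self_le (C : Matrix ι ι ℝ) : (C * C).trace ≤ (C * Cᵀ).trace := by
  have h : 0 ≤ ((C - Cᵀ) * (C - Cᵀ)ᵀ).trace := by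
    simp only [trace, diag_apply, mul_apply, transpose_apply]
    exact Finset.sum_nonneg fun i _ => Finset.sum_nonneg fun j _ => mul_self_nonneg _
  have h1 : (Cᵀ * Cᵀ).trace = (C * C).trace := by
    rw [← transpose_mul, trace_transpose]
  have h2 : (Cᵀ * C).trace = (C * Cᵀ).trace := trace_mul_comm _ _
  simp only [transpose_sub, transpose_transpose, sub_mul, mul_sub, trace_sub] at h
  linarith

theorem trace_mul_le_of_isSymm {P Q : Matrix ι ι ℝ} (hP : P.IsSymm) (hQ : Q.IsSymm) :
    (P * Q).trace ≤ ((P * P).trace + (Q * Q).trace) / 2 := by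
  have h : 0 ≤ ((P - Q) * (P - Q)ᵀ).trace := by
    simp only [trace, diag_apply, mul_apply, transpose_apply]
    exact Finset.sum_nonneg fun i _ => Finset.sum_nonneg fun j _ => mul_self_nonneg _
  have h2 : (Q * P).trace = (P * Q).trace := trace_mul_comm _ _
  rw [transpose_sub, hP.eq, hQ.eq] at h
  simp only [sub_mul, mul_sub, trace_sub] at h
  linarith

variable [DecidableEq ι]

theorem trace_mul_pow_comm (P Q : Matrix ι ι ℝ) (k : ℕ) :
    ((P * Q) ^ k).trace = ((Q * P) ^ k).trace := by
  rcases k with _ | k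
  · simp
  · have h : ∀ m : ℕ, (P * Q) ^ m * P = P * (Q * P) ^ m := by
      intro m
      induction m with
      | zero => simp
      | succ m ih => rw [pow_succ', mul_assoc, ih, pow_succ']; simp only [mul_assoc]
    rw [pow_succ, ← mul_assoc, h, mul_assoc, trace_mul_comm, pow_succ, mul_assoc]

/-- The two inequalities feed each other, hence the joint induction. For the first, apply it to C²,
rotate C²(C²)ᵀ cyclically into the product of the symmetric matrices CᵀC and CCᵀ, separate their
powers by the second, and use Young's inequality, since powers of CᵀC and CCᵀ have equal traces. For
the second, apply the first to C = PQ, which turns P, Q into P², Q². -/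
theorem trace_pow_two_pow_le (k : ℕ) :
    (∀ C : Matrix ι ι ℝ, (C ^ 2 ^ (k + 1)).trace ≤ ((C * Cᵀ) ^ 2 ^ k).trace) ∧
      ∀ P Q : Matrix ι ι ℝ, P.IsSymm → Q.IsSymm →
        ((P * Q) ^ 2 ^ k).trace ≤ (P ^ 2 ^ k * Q ^ 2 ^ k).trace := by
  induction k with
  | zero =>
    refine ⟨fun C => ?_, fun P Q _ _ => ?_⟩
    · simpa [pow_two] using trace_mul_self_le C
    · simp
  | succ k ih =>
    obtain ⟨ihC, ihA⟩ := ih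
    refine ⟨fun C => ?_, fun P Q hP hQ => ?_⟩
    · have hs1 : (Cᵀ * C).IsSymm := by rw [IsSymm, transpose_mul, transpose_transpose]
      have hs2 : (C * Cᵀ).IsSymm := by rw [IsSymm, transpose_mul, transpose_transpose]
      calc (C ^ 2 ^ (k + 1 + 1)).trace = ((C ^ 2) ^ 2 ^ (k + 1)).trace := by
            rw [← pow_mul, ← pow_succ']
        _ ≤ ((C ^ 2 * (C ^ 2)ᵀ) ^ 2 ^ k).trace := ihC _
        _ = ((C * (C * Cᵀ * Cᵀ)) ^ 2 ^ k).trace := by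
            rw [pow_two, transpose_mul]; simp only [mul_assoc]
        _ = ((Cᵀ * C * (C * Cᵀ)) ^ 2 ^ k).trace := by
            rw [trace_mul_pow_comm C, trace_mul_pow_comm (Cᵀ * C)]
            simp only [mul_assoc]
        _ ≤ ((Cᵀ * C) ^ 2 ^ k * (C * Cᵀ) ^ 2 ^ k).trace := ihA _ _ hs1 hs2
        _ ≤ _ := trace_mul_le_of_isSymm (hs1.pow _) (hs2.pow _)
        _ = ((C * Cᵀ) ^ 2 ^ (k + 1)).trace := by
            rw [← pow_add, ← pow_add, trace_mul_pow_comm Cᵀ, ← two_mul (2 ^ k), ← pow_succ']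
            ring
    · calc ((P * Q) ^ 2 ^ (k + 1)).trace ≤ ((P * Q * (P * Q)ᵀ) ^ 2 ^ k).trace := ihC _
        _ = ((P * P * (Q * Q)) ^ 2 ^ k).trace := by
            rw [transpose_mul, hP.eq, hQ.eq, mul_assoc P Q, trace_mul_pow_comm P,
              trace_mul_pow_comm (P * P)]
            simp only [mul_assoc]
        _ ≤ ((P * P) ^ 2 ^ k * (Q * Q) ^ 2 ^ k).trace :=
            ihA _ _ (by rw [IsSymm, transpose_mul, hP.eq]) (by rw [IsSymm, transpose_mul, hQ.eq])
        _ = _ := by simp only [← pow_two, ← pow_mul, ← pow_succ']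

/-- A trace inequality of Araki–Lieb–Thirring type. -/
theorem trace_mul_pow_two_pow_succ_le {P Q : Matrix ι ι ℝ} (hP : P.IsSymm) (hQ : Q.IsSymm)
    (k : ℕ) : ((P * Q) ^ 2 ^ (k + 1)).trace ≤ ((P ^ 2 * Q ^ 2) ^ 2 ^ k).trace := by
  calc ((P * Q) ^ 2 ^ (k + 1)).trace ≤ ((P * Q * (P * Q)ᵀ) ^ 2 ^ k).trace :=
        (trace_pow_two_pow_le k).1 _
    _ = ((P ^ 2 * Q ^ 2) ^ 2 ^ k).trace := by
        rw [transpose_mul, hP.eq, hQ.eq, mul_assoc P Q, trace_mul_pow_comm P,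
          trace_mul_pow_comm (P ^ 2)]
        simp only [mul_assoc, pow_two]

end TraceInequalities

/-! ### The Lie–Trotter product formula. -/

section LieTrotter

theorem norm_pow_sub_pow_le {𝔸 : Type*} [NormedRing 𝔸] [NormOneClass 𝔸] (S T : 𝔸) (c : ℝ)
    (hS : ‖S‖ ≤ c) (hT : ‖T‖ ≤ c) (N : ℕ) :
    ‖S ^ (N + 1) - T ^ (N + 1)‖ ≤ (N + 1) * c ^ N * ‖S - T‖ := by
  have hc : 0 ≤ c := (norm_nonneg _).trans hS
  induction N with
  | zero => simp
  | succ N ih =>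
    have h : S ^ (N + 1 + 1) - T ^ (N + 1 + 1)
        = S ^ (N + 1) * (S - T) + (S ^ (N + 1) - T ^ (N + 1)) * T := by
      rw [pow_succ S (N + 1), pow_succ T (N + 1)]; noncomm_ring
    have h1 : ‖S ^ (N + 1)‖ ≤ c ^ (N + 1) :=
      (norm_pow_le _ _).trans (pow_le_pow_left₀ (norm_nonneg _) hS _)
    calc ‖S ^ (N + 1 + 1) - T ^ (N + 1 + 1)‖
        ≤ ‖S ^ (N + 1)‖ * ‖S - T‖ + ‖S ^ (N + 1) - T ^ (N + 1)‖ * ‖T‖ := by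
          rw [h]; exact (norm_add_le _ _).trans (add_le_add (norm_mul_le _ _) (norm_mul_le _ _))
      _ ≤ c ^ (N + 1) * ‖S - T‖ + (N + 1) * c ^ N * ‖S - T‖ * c := by gcongr
      _ = _ := by push_cast; ring

theorem norm_exp_le_exp_norm {𝔸 : Type*} [NormedRing 𝔸] [NormOneClass 𝔸] [NormedAlgebra ℝ 𝔸]
    [CompleteSpace 𝔸] (A : 𝔸) : ‖NormedSpace.exp A‖ ≤ Real.exp ‖A‖ := by
  rw [Real.exp_eq_exp_ℝ, NormedSpace.exp_eq_tsum ℝ, NormedSpace.exp_eq_tsum ℝ]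
  refine tsum_of_norm_bounded (NormedSpace.expSeries_summable' (𝕂 := ℝ) ‖A‖).hasSum fun k => ?_
  rw [norm_smul, smul_eq_mul]
  gcongr
  · rw [Real.norm_of_nonneg (by positivity)]
  · exact norm_pow_le _ _

/-- The Lie–Trotter product formula. -/
theorem tendsto_exp_mul_exp_pow {𝔸 : Type*} [NormedRing 𝔸] [NormOneClass 𝔸] [NormedAlgebra ℝ 𝔸]
    [CompleteSpace 𝔸] (A B : 𝔸) :
    Tendsto (fun N : ℕ => (NormedSpace.exp (((N : ℝ) + 1)⁻¹ • A) *
      NormedSpace.exp (((N : ℝ) + 1)⁻¹ • B)) ^ (N + 1)) atTop (𝓝 (NormedSpace.exp (A + B))) := by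
  let : NormedAlgebra ℚ 𝔸 := NormedAlgebra.restrictScalars ℚ ℝ 𝔸
  -- The difference `f` vanishes to first order at 0, so (N+1)‖f(1/(N+1))‖ → 0. Telescoping the
  -- powers costs the factor N+1 and a bounded constant exp(‖A‖+‖B‖).
  let f : ℝ → 𝔸 := fun s => NormedSpace.exp (s • A) * NormedSpace.exp (s • B) -
    NormedSpace.exp (s • (A + B))
  have hf0 : f 0 = 0 := by simp [f]
  have hf : HasDerivAt f 0 0 := by
    have h1 := hasDerivAt_exp_smul_const (𝕂 := ℝ) A (0 : ℝ)
    have h2 := hasDerivAt_exp_smul_const (𝕂 := ℝ) B (0 : ℝ)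
    have h3 := hasDerivAt_exp_smul_const (𝕂 := ℝ) (A + B) (0 : ℝ)
    exact ((h1.mul h2).sub h3).congr_deriv (by simp)
  have hlim0 : Tendsto (fun N : ℕ => ((N : ℝ) + 1)⁻¹) atTop (𝓝[≠] 0) := by
    refine tendsto_nhdsWithin_iff.2 ⟨?_, Eventually.of_forall fun N => ?_⟩
    · simpa using tendsto_one_div_add_atTop_nhds_zero_nat (𝕜 := ℝ)
    · exact inv_ne_zero (by positivity)
  have hlim : Tendsto (fun N : ℕ => ((N : ℝ) + 1) * ‖f ((N : ℝ) + 1)⁻¹‖) atTop (𝓝 0) := by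
    have h := ((hasDerivAt_iff_tendsto_slope_zero.1 hf).comp hlim0).norm
    rw [norm_zero] at h
    refine h.congr fun N => ?_
    simp only [Function.comp, zero_add, hf0, sub_zero, inv_inv, norm_smul]
    rw [Real.norm_of_nonneg (by positivity)]
  have hexp : ∀ N : ℕ, NormedSpace.exp (((N : ℝ) + 1)⁻¹ • (A + B)) ^ (N + 1)
      = NormedSpace.exp (A + B) := by
    intro N
    rw [← NormedSpace.exp_nsmul, ← Nat.cast_smul_eq_nsmul ℝ, smul_smul]
    push_cast
    rw [mul_inv_cancel₀ (by positivity), one_smul]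
  rw [tendsto_iff_norm_sub_tendsto_zero]
  set K := ‖A‖ + ‖B‖ with hK
  refine squeeze_zero (fun _ => norm_nonneg _) (g := fun N : ℕ =>
    Real.exp K * (((N : ℝ) + 1) * ‖f ((N : ℝ) + 1)⁻¹‖)) (fun N => ?_)
    (by simpa using hlim.const_mul (Real.exp K))
  set s := ((N : ℝ) + 1)⁻¹ with hs
  have hspos : 0 ≤ s := by positivity
  have hS : ‖NormedSpace.exp (s • A) * NormedSpace.exp (s • B)‖ ≤ Real.exp (s * K) := by
    refine (norm_mul_le _ _).trans ?_
    rw [hK, mul_add, Real.exp_add]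
    gcongr <;>
    · refine (norm_exp_le_exp_norm _).trans_eq ?_
      rw [norm_smul, Real.norm_of_nonneg hspos]
  have hT : ‖NormedSpace.exp (s • (A + B))‖ ≤ Real.exp (s * K) := by
    refine (norm_exp_le_exp_norm _).trans (Real.exp_le_exp.2 ?_)
    rw [norm_smul, Real.norm_of_nonneg hspos]
    gcongr
    exact norm_add_le _ _
  have hmain := norm_pow_sub_pow_le _ _ _ hS hT N
  rw [hexp N] at hmain
  refine hmain.trans ?_
  have hc : Real.exp (s * K) ^ N ≤ Real.exp K := by
    rw [← Real.exp_nat_mul]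
    refine Real.exp_le_exp.2 ?_
    have hK0 : 0 ≤ K := by positivity
    have : (N : ℝ) * s ≤ 1 := by
      rw [hs, ← div_eq_mul_inv, div_le_one (by positivity)]; linarith
    nlinarith
  calc ((N : ℝ) + 1) * Real.exp (s * K) ^ N * ‖f s‖ ≤ (N + 1) * Real.exp K * ‖f s‖ := by gcongr
    _ = _ := by ring

end LieTrotter

/-! ### Golden–Thompson inequalities at dyadic levels. -/

section GoldenThompson

variable {ι : Type*} [Fintype ι] [DecidableEq ι]

attribute [local instance] Matrix.linftyOpNormedRing Matrix.linftyOpNormedAlgebra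

theorem isSymm_exp {Y : Matrix ι ι ℝ} (hY : Y.IsSymm) : (NormedSpace.exp Y).IsSymm :=
  hY.exp

theorem exp_inv_two_smul_sq (Y : Matrix ι ι ℝ) :
    NormedSpace.exp ((2 : ℝ)⁻¹ • Y) ^ 2 = NormedSpace.exp Y := by
  rw [← Matrix.exp_nsmul, ← Nat.cast_smul_eq_nsmul ℝ, smul_smul]
  norm_num

variable [Nonempty ι]

/-- A family of refinements of the Golden–Thompson inequality. -/
theorem trace_exp_add_le (Y Z : Matrix ι ι ℝ) (hY : Y.IsSymm) (hZ : Z.IsSymm) (k : ℕ) :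
    (NormedSpace.exp (Y + Z)).trace ≤
      ((NormedSpace.exp (((2 : ℝ) ^ k)⁻¹ • Y) *
        NormedSpace.exp (((2 : ℝ) ^ k)⁻¹ • Z)) ^ 2 ^ k).trace := by
  let a : ℕ → ℝ := fun k => ((NormedSpace.exp (((2 : ℝ) ^ k)⁻¹ • Y) *
    NormedSpace.exp (((2 : ℝ) ^ k)⁻¹ • Z)) ^ 2 ^ k).trace
  -- Halving the exponents while doubling the power can only decrease the trace, and the limit is
  -- the left-hand side, so every level is an upper bound. Level 0 is Golden–Thompson itself.
  have ha : Antitone a := by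
    refine antitone_nat_of_succ_le fun k => ?_
    refine (trace_mul_pow_two_pow_succ_le (isSymm_exp (hY.smul _)) (isSymm_exp (hZ.smul _))
      k).trans_eq ?_
    have h : ∀ X : Matrix ι ι ℝ, ((2 : ℝ) ^ (k + 1))⁻¹ • X = (2 : ℝ)⁻¹ • ((2 : ℝ) ^ k)⁻¹ • X := by
      intro X; rw [smul_smul, pow_succ, mul_inv, mul_comm]
    rw [h, h, exp_inv_two_smul_sq, exp_inv_two_smul_sq]
  have hlim : Tendsto a atTop (𝓝 (NormedSpace.exp (Y + Z)).trace) := by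
    -- The product formula is stated with N+1 factors, hence the subsequence N = 2^k − 1.
    have h1 : Tendsto (fun k : ℕ => 2 ^ k - 1) atTop atTop :=
      (tendsto_sub_atTop_nat 1).comp (tendsto_pow_atTop_atTop_of_one_lt one_lt_two)
    have h2 := (tendsto_exp_mul_exp_pow Y Z).comp h1
    have h3 : Continuous fun X : Matrix ι ι ℝ => X.trace := continuous_id.matrix_trace
    refine ((h3.tendsto _).comp h2).congr fun k => ?_
    have h4 : 1 ≤ 2 ^ k := Nat.one_le_two_pow
    simp only [Function.comp, a, Nat.cast_sub h4, Nat.sub_add_cancel h4]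
    norm_num
    rfl
  exact ha.le_of_tendsto hlim k

end GoldenThompson

end BSBM

namespace BSBM

open Matrix

/-! ### Quadratic bounds for the exponential. -/

section ExpBounds

/-- Termwise comparison of power series: (k+3)! ≥ 6 (k+1)!, so the tail from order 3 is at most s²/6
times the tail from order 1. -/
theorem exp_sub_quadratic_le {s : ℝ} (hs : 0 ≤ s) :
    Real.exp s ≤ 1 + s + s ^ 2 / 2 + s ^ 2 * ((Real.exp s - 1) / 6) := by
  have h0 : HasSum (fun k : ℕ => s ^ k / k.factorial) (Real.exp s) := by
    simpa [Real.exp_eq_exp_ℝ] using NormedSpace.expSeries_div_hasSum_exp s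
  have h3 := (hasSum_nat_add_iff' 3).2 h0
  have h1 := ((hasSum_nat_add_iff' 1).2 h0).mul_left (s ^ 2 / 6)
  have h := hasSum_le (fun k => ?_) h3 h1
  · simp [Finset.sum_range_succ] at h
    linarith
  · have hf : ((k + 3).factorial : ℝ) = (k + 3) * (k + 2) * (k + 1).factorial := by
      rw [Nat.factorial_succ (k + 2), Nat.factorial_succ (k + 1)]; push_cast; ring
    have hp : (0 : ℝ) < (k + 1).factorial := by positivity
    have e : s ^ 2 / 6 * (s ^ (k + 1) / (k + 1).factorial)
        = s ^ (k + 3) / (6 * (k + 1).factorial) := by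
      field_simp; ring
    rw [hf, e]
    gcongr
    nlinarith

theorem exp_le_quadratic_add {s ζ : ℝ} (hs : |s| ≤ ζ) :
    Real.exp s ≤ 1 + s + s ^ 2 / 2 + s ^ 2 * ((Real.exp ζ - 1) / 6) := by
  rcases le_total 0 s with h | h
  · refine (exp_sub_quadratic_le h).trans ?_
    have : Real.exp s ≤ Real.exp ζ := Real.exp_le_exp.2 ((le_abs_self s).trans hs)
    gcongr
  · have h1 : Real.exp s ≤ 1 + s + s ^ 2 / 2 := by
      have h2 := Real.quadratic_le_exp_of_nonneg (neg_nonneg.2 h)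
      have h3 : Real.exp s * Real.exp (-s) = 1 := by rw [← Real.exp_add]; simp
      have h4 : 0 < Real.exp s := Real.exp_pos s
      have h5 : 1 + s + s ^ 2 / 2 > 0 := by nlinarith [sq_nonneg (s + 1)]
      have h6 := mul_le_mul_of_nonneg_left h2 h4.le
      rw [h3] at h6
      -- The product equals 1 + s⁴/4. For s ≤ 0 the quadratic polynomial alone thus dominates exp s.
      have h7 : 1 ≤ (1 + s + s ^ 2 / 2) * (1 + -s + (-s) ^ 2 / 2) := by
        nlinarith [sq_nonneg (s ^ 2)]
      have h8 : 0 < 1 + -s + (-s) ^ 2 / 2 := by nlinarith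
      nlinarith
    have h2 : 1 ≤ Real.exp ζ := Real.one_le_exp ((abs_nonneg s).trans hs)
    have : 0 ≤ s ^ 2 * ((Real.exp ζ - 1) / 6) := by
      have : 0 ≤ (Real.exp ζ - 1) / 6 := by linarith
      positivity
    linarith

/-- Second-order expansion of a weighted sum of exponentials of the means `(z a + z b) / 2`. -/
theorem sum_mul_exp_le {ι : Type*} [Fintype ι] (P : ι → ι → ℝ) (hP : ∀ a b, 0 ≤ P a b)
    (hsymm : ∀ a b, P a b = P b a) (z : ι → ℝ) (ζ : ℝ) (hz : ∀ a, |z a| ≤ ζ) :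
    ∑ a, ∑ b, P a b * Real.exp ((z a + z b) / 2) ≤
      ∑ a, ∑ b, P a b * (1 + z a + z a ^ 2 / 4 + z a * z b / 4
        + (Real.exp ζ - 1) / 6 * z a ^ 2) := by
  set c := (Real.exp ζ - 1) / 6 with hc
  -- The asymmetric summand `G` has the same double sum as its symmetrisation, and the latter
  -- dominates the exponential of the mean pointwise. The asymmetric form matches traces such as
  -- tr(M²Z²) directly.
  let G : ι → ι → ℝ := fun a b => P a b * (1 + z a + z a ^ 2 / 4 + z a * z b / 4 + c * z a ^ 2)
  have hswap : ∑ a, ∑ b, G a b = ∑ a, ∑ b, G b a := Finset.sum_comm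
  have key : ∑ a, ∑ b, P a b * Real.exp ((z a + z b) / 2)
      ≤ ∑ a, ∑ b, (G a b + G b a) / 2 := by
    refine Finset.sum_le_sum fun a _ => Finset.sum_le_sum fun b _ => ?_
    have hs : |(z a + z b) / 2| ≤ ζ := by
      have := abs_le.1 (hz a)
      have := abs_le.1 (hz b)
      exact abs_le.2 ⟨by linarith, by linarith⟩
    have h := exp_le_quadratic_add hs
    rw [← hc] at h
    have hc0 : 0 ≤ c := by
      have : 1 ≤ Real.exp ζ := Real.one_le_exp ((abs_nonneg _).trans (hz a))
      rw [hc]; linarith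
    have h2 : ((z a + z b) / 2) ^ 2 * c ≤ c * (z a ^ 2 + z b ^ 2) / 2 := by
      nlinarith [mul_nonneg hc0 (sq_nonneg (z a - z b))]
    have h3 : (G a b + G b a) / 2 = P a b * (1 + (z a + z b) / 2 + ((z a + z b) / 2) ^ 2 / 2
        + c * (z a ^ 2 + z b ^ 2) / 2) := by
      simp only [G, hsymm b a]; ring
    rw [h3]
    exact mul_le_mul_of_nonneg_left (by linarith) (hP a b)
  refine key.trans_eq ?_
  simp only [← Finset.sum_div, Finset.sum_add_distrib]
  rw [← hswap]
  ring

end ExpBounds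

/-! ### Second-order perturbation of trace exponentials. -/

section OneStep

variable {ι : Type*} [Fintype ι]

theorem trace_mul_conj {U : Matrix ι ι ℝ} (M D : Matrix ι ι ℝ) :
    (M * (U * D * Uᵀ)).trace = (Uᵀ * M * U * D).trace := by
  rw [← mul_assoc, trace_mul_comm]; simp only [mul_assoc]

variable [DecidableEq ι]

theorem exists_orthogonal_diagonalization {Z : Matrix ι ι ℝ} (hZ : Z.IsSymm) :
    ∃ (U : Matrix ι ι ℝ) (z : ι → ℝ), U * Uᵀ = 1 ∧ Uᵀ * U = 1 ∧ Z = U * diagonal z * Uᵀ := by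
  have hH : Z.IsHermitian := by rw [IsHermitian, conjTranspose_eq_transpose_of_trivial]; exact hZ
  refine ⟨hH.eigenvectorUnitary, hH.eigenvalues, ?_, ?_, ?_⟩
  · simpa [star_eq_conjTranspose, conjTranspose_eq_transpose_of_trivial] using
      Unitary.coe_mul_star_self hH.eigenvectorUnitary
  · simpa [star_eq_conjTranspose, conjTranspose_eq_transpose_of_trivial] using
      Unitary.coe_star_mul_self hH.eigenvectorUnitary
  · have := hH.spectral_theorem
    rw [Unitary.conjStarAlgAut_apply] at this
    simpa [star_eq_conjTranspose, conjTranspose_eq_transpose_of_trivial, Function.comp_def]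
      using this

theorem exp_conj_diagonal {U : Matrix ι ι ℝ} (h1 : U * Uᵀ = 1) (z : ι → ℝ) :
    NormedSpace.exp (U * diagonal z * Uᵀ) = U * diagonal (fun a => Real.exp (z a)) * Uᵀ := by
  have hU : IsUnit U := IsUnit.of_mul_eq_one _ h1
  have hinv : U⁻¹ = Uᵀ := inv_eq_right_inv h1
  rw [← hinv, exp_conj _ _ hU, exp_diagonal, Real.exp_eq_exp_ℝ]
  congr 3
  ext a
  rw [Pi.coe_exp]

theorem trace_mul_diagonal (M : Matrix ι ι ℝ) (d : ι → ℝ) :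
    (M * diagonal d).trace = ∑ a, M a a * d a := by
  simp [trace, mul_diagonal]

theorem trace_mul_diagonal_mul_diagonal {M : Matrix ι ι ℝ} (hM : M.IsSymm) (d e : ι → ℝ) :
    (M * diagonal d * (M * diagonal e)).trace = ∑ a, ∑ b, M a b ^ 2 * (e a * d b) := by
  simp only [trace, diag_apply, mul_apply (M := M * diagonal d), mul_diagonal]
  refine Finset.sum_congr rfl fun a _ => Finset.sum_congr rfl fun b _ => ?_
  rw [hM.apply a b]; ring

/-- The diagonal entries of a real symmetric square are nonnegative after conjugation. -/
theorem conj_diag_nonneg {U B : Matrix ι ι ℝ} (hB : B.IsSymm) (a : ι) :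
    0 ≤ (Uᵀ * (B ^ 2) * U) a a := by
  have h : Uᵀ * B ^ 2 * U = (B * U)ᵀ * (B * U) := by
    rw [transpose_mul, hB.eq, pow_two]; simp only [mul_assoc]
  rw [h, mul_apply]
  exact Finset.sum_nonneg fun i _ => mul_self_nonneg _

theorem abs_le_of_trace_sq_le {U : Matrix ι ι ℝ} {z : ι → ℝ} {ζ : ℝ} (h2 : Uᵀ * U = 1)
    (hζ : 0 ≤ ζ) (h : (U * diagonal z * Uᵀ * (U * diagonal z * Uᵀ)).trace ≤ ζ ^ 2) (a : ι) :
    |z a| ≤ ζ := by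
  have e : (U * diagonal z * Uᵀ * (U * diagonal z * Uᵀ)).trace = ∑ a, z a ^ 2 := by
    rw [trace_mul_conj, show Uᵀ * (U * diagonal z * Uᵀ) * U * diagonal z
      = (Uᵀ * U) * diagonal z * (Uᵀ * U) * diagonal z by simp only [mul_assoc], h2, one_mul, mul_one,
      diagonal_mul_diagonal, trace_diagonal]
    simp [pow_two]
  rw [e] at h
  refine abs_le_of_sq_le_sq ?_ hζ
  exact (Finset.single_le_sum (f := fun a => z a ^ 2) (fun i _ => sq_nonneg _)
    (Finset.mem_univ a)).trans h

variable [Nonempty ι]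

/-- Second-order bound for the trace exponential of a perturbed matrix. -/
theorem trace_exp_add_le_second_order {Y Z : Matrix ι ι ℝ} (hY : Y.IsSymm) (hZ : Z.IsSymm)
    {ζ : ℝ} (hζ : 0 ≤ ζ) (h : (Z * Z).trace ≤ ζ ^ 2) {M : Matrix ι ι ℝ}
    (hM : M = NormedSpace.exp ((2 : ℝ)⁻¹ • Y)) :
    (NormedSpace.exp (Y + Z)).trace ≤ (M * M).trace + (M * M * Z).trace
      + (M * M * (Z * Z)).trace / 4 + (M * Z * (M * Z)).trace / 4
      + (Real.exp ζ - 1) / 6 * (M * M * (Z * Z)).trace := by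
  obtain ⟨U, z, h1, h2, hUZ⟩ := exists_orthogonal_diagonalization hZ
  have hMs : M.IsSymm := hM ▸ isSymm_exp (hY.smul _)
  set N := Uᵀ * M * U with hN
  have hNs : N.IsSymm := by
    rw [hN, IsSymm, transpose_mul, transpose_mul, transpose_transpose, hMs.eq, mul_assoc]
  have hz : ∀ a, |z a| ≤ ζ := abs_le_of_trace_sq_le h2 hζ (by rw [← hUZ]; exact h)
  have hc : ∀ d e : ι → ℝ, (M * (U * diagonal d * Uᵀ) * (M * (U * diagonal e * Uᵀ))).trace
      = ∑ a, ∑ b, N a b ^ 2 * (e a * d b) := by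
    intro d e
    rw [← trace_mul_diagonal_mul_diagonal hNs, ← mul_assoc, trace_mul_conj, hN]
    simp only [mul_assoc]
  have hone : U * diagonal (fun _ => (1 : ℝ)) * Uᵀ = 1 := by
    rw [diagonal_one, mul_one, h1]
  have hsq : Z * Z = U * diagonal (fun a => z a ^ 2) * Uᵀ := by
    rw [hUZ, show U * diagonal z * Uᵀ * (U * diagonal z * Uᵀ)
      = U * (diagonal z * (Uᵀ * U) * diagonal z) * Uᵀ by simp only [mul_assoc], h2, mul_one,
      diagonal_mul_diagonal]
    simp only [pow_two]
  have e0 : (M * M).trace = ∑ a, ∑ b, N a b ^ 2 := by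
    simpa [h1] using hc (fun _ => 1) fun _ => 1
  have e1 : (M * M * Z).trace = ∑ a, ∑ b, N a b ^ 2 * z a := by
    have := hc (fun _ => 1) z
    rw [hone, ← hUZ] at this
    simpa [mul_assoc] using this
  have e2 : (M * M * (Z * Z)).trace = ∑ a, ∑ b, N a b ^ 2 * z a ^ 2 := by
    have := hc (fun _ => 1) fun a => z a ^ 2
    rw [hone, ← hsq] at this
    simpa [mul_assoc] using this
  have e3 : (M * Z * (M * Z)).trace = ∑ a, ∑ b, N a b ^ 2 * (z a * z b) := by
    rw [← hc, ← hUZ]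
  have e4 : NormedSpace.exp ((2 : ℝ)⁻¹ • Z) = U * diagonal (fun a => Real.exp (z a / 2)) * Uᵀ := by
    rw [hUZ, ← exp_conj_diagonal h1, ← smul_mul_assoc, ← mul_smul_comm, ← diagonal_smul]
    congr 5
    ext a
    simp [div_eq_inv_mul]
  -- Level 1 is essential: in the eigenbasis of Z it becomes a sum of N_ab² exp((z_a+z_b)/2), which
  -- retains the mixed term tr(MZMZ). Level 0 would give only tr(M²Z²)/2.
  have hGT := trace_exp_add_le Y Z hY hZ 1
  rw [pow_one, pow_one, pow_two, ← hM, e4, hc] at hGT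
  have hexp : ∀ a b, Real.exp (z a / 2) * Real.exp (z b / 2) = Real.exp ((z a + z b) / 2) := by
    intro a b; rw [← Real.exp_add]; ring_nf
  simp only [hexp] at hGT
  refine hGT.trans ((sum_mul_exp_le (fun a b => N a b ^ 2) (fun _ _ => sq_nonneg _)
    (fun a b => by rw [hNs.apply]) z ζ hz).trans_eq ?_)
  rw [e0, e1, e2, e3]
  simp only [Finset.mul_sum, Finset.sum_div, ← Finset.sum_add_distrib]
  refine Finset.sum_congr rfl fun a _ => Finset.sum_congr rfl fun b _ => ?_
  ring

/-- Second-order bound for the squared trace of the exponential of half a perturbed matrix. -/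
theorem sq_trace_exp_add_le_second_order {Y Z : Matrix ι ι ℝ} (hY : Y.IsSymm) (hZ : Z.IsSymm)
    {ζ : ℝ} (hζ : 0 ≤ ζ) (h : (Z * Z).trace ≤ ζ ^ 2) {M : Matrix ι ι ℝ}
    (hM : M = NormedSpace.exp ((2 : ℝ)⁻¹ • Y)) :
    (NormedSpace.exp ((2 : ℝ)⁻¹ • (Y + Z))).trace ^ 2 ≤ M.trace ^ 2 + M.trace * (M * Z).trace
      + M.trace * (M * (Z * Z)).trace / 4 + (M * Z).trace ^ 2 / 4
      + (Real.exp ζ - 1) / 6 * (M.trace * (M * (Z * Z)).trace) := by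
  obtain ⟨U, z, h1, h2, hUZ⟩ := exists_orthogonal_diagonalization hZ
  have hBs : (NormedSpace.exp ((2 : ℝ)⁻¹ • (2 : ℝ)⁻¹ • Y)).IsSymm :=
    isSymm_exp ((hY.smul _).smul _)
  have hB : M = NormedSpace.exp ((2 : ℝ)⁻¹ • (2 : ℝ)⁻¹ • Y) ^ 2 := by
    rw [exp_inv_two_smul_sq, hM]
  set N := Uᵀ * M * U with hN
  have hN0 : ∀ a, 0 ≤ N a a := fun a => by rw [hN, hB]; exact conj_diag_nonneg hBs a
  have hz : ∀ a, |z a| ≤ ζ := abs_le_of_trace_sq_le h2 hζ (by rw [← hUZ]; exact h)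
  have hc : ∀ d : ι → ℝ, (M * (U * diagonal d * Uᵀ)).trace = ∑ a, N a a * d a := by
    intro d
    rw [← trace_mul_diagonal, trace_mul_conj, hN]
  have hsq : Z * Z = U * diagonal (fun a => z a ^ 2) * Uᵀ := by
    rw [hUZ, show U * diagonal z * Uᵀ * (U * diagonal z * Uᵀ)
      = U * (diagonal z * (Uᵀ * U) * diagonal z) * Uᵀ by simp only [mul_assoc], h2, mul_one,
      diagonal_mul_diagonal]
    simp only [pow_two]
  have e0 : M.trace = ∑ a, N a a := by
    simpa [h1] using hc fun _ => 1
  have e1 : (M * Z).trace = ∑ a, N a a * z a := by rw [← hc, ← hUZ]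
  have e2 : (M * (Z * Z)).trace = ∑ a, N a a * z a ^ 2 := by rw [hsq, hc]
  have e4 : NormedSpace.exp ((2 : ℝ)⁻¹ • Z) = U * diagonal (fun a => Real.exp (z a / 2)) * Uᵀ := by
    rw [hUZ, ← exp_conj_diagonal h1, ← smul_mul_assoc, ← mul_smul_comm, ← diagonal_smul]
    congr 5
    ext a
    simp [div_eq_inv_mul]
  -- For the halved exponents level 0 suffices: its square is a double sum with weights N_aa N_bb ≥
  -- 0, so `sum_mul_exp_le` applies again.
  have hGT := trace_exp_add_le ((2 : ℝ)⁻¹ • Y) ((2 : ℝ)⁻¹ • Z) (hY.smul _) (hZ.smul _) 0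
  rw [pow_zero, pow_zero, inv_one, one_smul, one_smul, pow_one, ← hM, e4, hc, ← smul_add] at hGT
  have h0 : 0 ≤ (NormedSpace.exp ((2 : ℝ)⁻¹ • (Y + Z))).trace := by
    rw [← exp_inv_two_smul_sq]
    have hs := isSymm_exp (((hY.add hZ).smul (2 : ℝ)⁻¹).smul (2 : ℝ)⁻¹)
    refine Finset.sum_nonneg fun a _ => ?_
    simpa using conj_diag_nonneg (U := 1) hs a
  have hexp : ∀ a b, Real.exp (z a / 2) * Real.exp (z b / 2) = Real.exp ((z a + z b) / 2) := by
    intro a b; rw [← Real.exp_add]; ring_nf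
  refine (pow_le_pow_left₀ h0 hGT 2).trans ?_
  have key := sum_mul_exp_le (fun a b => N a a * N b b) (fun a b => mul_nonneg (hN0 a) (hN0 b))
    (fun a b => mul_comm _ _) z ζ hz
  rw [pow_two, Finset.sum_mul_sum]
  calc _ = ∑ a, ∑ b, N a a * N b b * Real.exp ((z a + z b) / 2) :=
        Finset.sum_congr rfl fun a _ => Finset.sum_congr rfl fun b _ => by rw [← hexp]; ring
    _ ≤ _ := key
    _ = _ := by
        rw [mul_comm M.trace (M * Z).trace, mul_comm M.trace (M * (Z * Z)).trace, e0, e1, e2]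
        simp only [pow_two, Finset.sum_mul_sum]
        simp only [Finset.mul_sum, Finset.sum_div, ← Finset.sum_add_distrib]
        refine Finset.sum_congr rfl fun a _ => Finset.sum_congr rfl fun b _ => ?_
        ring

end OneStep

end BSBM

namespace BSBM

open Matrix

/-! ### Expectations over independent Bernoulli coordinates. -/

section ColumnExpectation

variable {ι : Type*} [Fintype ι]

/-- The mass given to `x` by the Bernoulli law with parameter `q`. -/
def bernWeight (q : ℝ) (x : Bool) : ℝ := if x then q else 1 - q

/-- The centred value of a Bernoulli variable with parameter `q` at the outcome `x`. -/
def bernDev (q : ℝ) (x : Bool) : ℝ := (if x then 1 else 0) - q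

/-- The expectation of a function of a Bernoulli variable with parameter `q`. -/
def bernExp (q : ℝ) (φ : Bool → ℝ) : ℝ := ∑ x, bernWeight q x * φ x

/-- The expectation of a function of independent Bernoulli variables with parameters `q i`. -/
def colExp [DecidableEq ι] (q : ι → ℝ) (f : (ι → Bool) → ℝ) : ℝ :=
  ∑ w, (∏ i, bernWeight (q i) (w i)) * f w

theorem bernExp_eq (q : ℝ) (φ : Bool → ℝ) : bernExp q φ = q * φ true + (1 - q) * φ false := by
  simp [bernExp, bernWeight]

theorem bernWeight_nonneg {q : ℝ} (h0 : 0 ≤ q) (h1 : q ≤ 1) (x : Bool) : 0 ≤ bernWeight q x := by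
  cases x <;> simp [bernWeight, h0, h1]

theorem bernExp_dev (q : ℝ) : bernExp q (bernDev q) = 0 := by
  simp [bernExp_eq, bernDev]; ring

theorem bernExp_dev_sq (q : ℝ) : bernExp q (fun x => bernDev q x ^ 2) = q * (1 - q) := by
  simp [bernExp_eq, bernDev]; ring

theorem bernExp_mono {q : ℝ} (h0 : 0 ≤ q) (h1 : q ≤ 1) {φ ψ : Bool → ℝ} (h : ∀ x, φ x ≤ ψ x) :
    bernExp q φ ≤ bernExp q ψ :=
  Finset.sum_le_sum fun x _ => mul_le_mul_of_nonneg_left (h x) (bernWeight_nonneg h0 h1 x)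

theorem abs_bernDev_le {q : ℝ} (h0 : 0 ≤ q) (h1 : q ≤ 1) (x : Bool) : |bernDev q x| ≤ 1 := by
  cases x <;> simp [bernDev, abs_le] <;> constructor <;> linarith

theorem bernDev_sq_le {q : ℝ} (h0 : 0 ≤ q) (h1 : q ≤ 1) (x : Bool) : bernDev q x ^ 2 ≤ 1 := by
  rw [sq_le_one_iff_abs_le_one]; exact abs_bernDev_le h0 h1 x

theorem exp_mul_le_of_le_one {θ x : ℝ} (hx0 : 0 ≤ x) (hx1 : x ≤ 1) :
    Real.exp (θ * x) ≤ 1 + (Real.exp θ - 1) * x := by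
  have := convexOn_exp.2 (Set.mem_univ 0) (Set.mem_univ θ) (sub_nonneg.2 hx1) hx0 (by ring)
  simp only [smul_eq_mul, mul_zero, zero_add, Real.exp_zero] at this
  rw [mul_comm θ x]
  linarith

theorem bernExp_exp_le {q θ : ℝ} (h0 : 0 ≤ q) (h1 : q ≤ 1) :
    bernExp q (fun x => Real.exp (θ * bernDev q x ^ 2)) ≤
      Real.exp (q * (1 - q) * (Real.exp θ - 1)) := by
  calc _ ≤ bernExp q (fun x => 1 + (Real.exp θ - 1) * bernDev q x ^ 2) :=
        bernExp_mono h0 h1 fun x => exp_mul_le_of_le_one (sq_nonneg _) (bernDev_sq_le h0 h1 x)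
    _ = q * (1 - q) * (Real.exp θ - 1) + 1 := by simp [bernExp_eq, bernDev]; ring
    _ ≤ _ := Real.add_one_le_exp _

theorem bernExp_sq_mul_exp_le {q θ : ℝ} (h0 : 0 ≤ q) (h1 : q ≤ 1) (hθ : 0 ≤ θ) :
    bernExp q (fun x => bernDev q x ^ 2 * Real.exp (θ * bernDev q x ^ 2)) ≤
      q * (1 - q) * Real.exp θ := by
  calc _ ≤ bernExp q (fun x => bernDev q x ^ 2 * Real.exp θ) := by
        refine bernExp_mono h0 h1 fun x => ?_
        have := bernDev_sq_le h0 h1 x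
        gcongr
        nlinarith
    _ = _ := by simp [bernExp_eq, bernDev]; ring

theorem bernExp_sq_mul_exp_nonneg {q θ : ℝ} (h0 : 0 ≤ q) (h1 : q ≤ 1) :
    0 ≤ bernExp q (fun x => bernDev q x ^ 2 * Real.exp (θ * bernDev q x ^ 2)) :=
  Finset.sum_nonneg fun x _ => mul_nonneg (bernWeight_nonneg h0 h1 x) (by positivity)

/-- The deviation is centred, so 1 may be subtracted from the exponential. The small factor e^θ − 1
gained for each unpaired coordinate keeps the off-diagonal third-order terms under control. -/
theorem abs_bernExp_mul_exp_le {q θ : ℝ} (h0 : 0 ≤ q) (h1 : q ≤ 1) (hθ : 0 ≤ θ) :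
    |bernExp q (fun x => bernDev q x * Real.exp (θ * bernDev q x ^ 2))| ≤
      q * (1 - q) * (Real.exp θ - 1) := by
  have e : bernExp q (fun x => bernDev q x * Real.exp (θ * bernDev q x ^ 2))
      = bernExp q (fun x => bernDev q x * (Real.exp (θ * bernDev q x ^ 2) - 1)) := by
    have := bernExp_dev q
    simp only [bernExp_eq] at this ⊢
    linarith
  have hb : ∀ x, |bernDev q x * (Real.exp (θ * bernDev q x ^ 2) - 1)|
      ≤ (Real.exp θ - 1) * bernDev q x ^ 2 := by
    intro x
    have h2 := exp_mul_le_of_le_one (θ := θ) (sq_nonneg _) (bernDev_sq_le h0 h1 x)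
    have h3 : 1 ≤ Real.exp (θ * bernDev q x ^ 2) := Real.one_le_exp (by positivity)
    rw [abs_mul, abs_of_nonneg (sub_nonneg.2 h3)]
    have h4 := abs_bernDev_le h0 h1 x
    nlinarith [abs_nonneg (bernDev q x)]
  rw [e]
  calc _ ≤ bernExp q (fun x => |bernDev q x * (Real.exp (θ * bernDev q x ^ 2) - 1)|) := by
        refine (Finset.abs_sum_le_sum_abs _ _).trans_eq (Finset.sum_congr rfl fun x _ => ?_)
        rw [abs_mul, abs_of_nonneg (bernWeight_nonneg h0 h1 x)]
    _ ≤ bernExp q (fun x => (Real.exp θ - 1) * bernDev q x ^ 2) := bernExp_mono h0 h1 hb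
    _ = _ := by simp [bernExp_eq, bernDev]; ring

variable [DecidableEq ι]

theorem colExp_add (q : ι → ℝ) (f g : (ι → Bool) → ℝ) :
    colExp q (fun w => f w + g w) = colExp q f + colExp q g := by
  simp [colExp, mul_add, Finset.sum_add_distrib]

theorem colExp_sub (q : ι → ℝ) (f g : (ι → Bool) → ℝ) :
    colExp q (fun w => f w - g w) = colExp q f - colExp q g := by
  simp [colExp, mul_sub, Finset.sum_sub_distrib]

theorem colExp_const_mul (q : ι → ℝ) (c : ℝ) (f : (ι → Bool) → ℝ) :
    colExp q (fun w => c * f w) = c * colExp q f := by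
  simp only [colExp, Finset.mul_sum]
  exact Finset.sum_congr rfl fun w _ => by ring

theorem colExp_sum {κ : Type*} (s : Finset κ) (q : ι → ℝ) (f : κ → (ι → Bool) → ℝ) :
    colExp q (fun w => ∑ k ∈ s, f k w) = ∑ k ∈ s, colExp q (f k) := by
  simp only [colExp, Finset.mul_sum]
  exact Finset.sum_comm

theorem colExp_mono {q : ι → ℝ} (h0 : ∀ i, 0 ≤ q i) (h1 : ∀ i, q i ≤ 1)
    {f g : (ι → Bool) → ℝ} (h : ∀ w, f w ≤ g w) : colExp q f ≤ colExp q g :=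
  Finset.sum_le_sum fun w _ => mul_le_mul_of_nonneg_left (h w)
    (Finset.prod_nonneg fun i _ => bernWeight_nonneg (h0 i) (h1 i) _)

theorem colExp_prod (q : ι → ℝ) (f : ι → Bool → ℝ) :
    colExp q (fun w => ∏ i, f i (w i)) = ∏ i, bernExp (q i) (f i) := by
  simp only [colExp, bernExp, ← Finset.prod_mul_distrib]
  rw [Finset.prod_univ_sum, Fintype.piFinset_univ]

theorem colExp_const (q : ι → ℝ) (c : ℝ) : colExp q (fun _ => c) = c := by
  have h := colExp_prod q (fun _ _ => 1)
  have h1 : ∀ i, bernExp (q i) (fun _ => 1) = 1 := fun i => by simp [bernExp_eq]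
  simp only [Finset.prod_const_one, h1] at h
  simpa [h] using colExp_const_mul q c fun _ => 1

/-- Independence of a coordinate from a function not depending on it. -/
theorem colExp_mul_of_indep (q : ι → ℝ) (a : ι) (φ : Bool → ℝ) (f : (ι → Bool) → ℝ)
    (hf : ∀ w x, f (Function.update w a x) = f w) :
    colExp q (fun w => φ (w a) * f w) = bernExp (q a) φ * colExp q f := by
  -- Coordinate `a` is split off. The remaining sum does not involve ψ, so it is identified by
  -- taking ψ = 1.
  have key : ∀ ψ : Bool → ℝ, colExp q (fun w => ψ (w a) * f w) =
      bernExp (q a) ψ * ∑ w : ({i // i ≠ a} → Bool), (∏ i, bernWeight (q i.1) (w i)) *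
        f ((Equiv.funSplitAt a Bool).symm (false, w)) := by
    intro ψ
    rw [colExp, ← (Equiv.funSplitAt a Bool).symm.sum_comp, Fintype.sum_prod_type, bernExp,
      Finset.sum_mul_sum]
    refine Finset.sum_congr rfl fun x _ => Finset.sum_congr rfl fun w _ => ?_
    have e1 : (Equiv.funSplitAt a Bool).symm (x, w) a = x := by simp
    have e2 : f ((Equiv.funSplitAt a Bool).symm (x, w))
        = f ((Equiv.funSplitAt a Bool).symm (false, w)) := by
      rw [← hf ((Equiv.funSplitAt a Bool).symm (x, w)) false]
      congr 1
      ext i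
      by_cases h : i = a
      · subst h; simp
      · simp [h]
    have e3 : ∏ i, bernWeight (q i) ((Equiv.funSplitAt a Bool).symm (x, w) i)
        = bernWeight (q a) x * ∏ i : {i // i ≠ a}, bernWeight (q i) (w i) := by
      rw [Fintype.prod_eq_mul_prod_subtype_ne _ a, e1]
      congr 1
      refine Finset.prod_congr rfl fun i _ => ?_
      simp [i.2]
    rw [e1, e2, e3]
    ring
  have h1 := key fun _ => 1
  have h2 : bernExp (q a) (fun _ => 1) = 1 := by simp [bernExp_eq]
  simp only [one_mul, h2] at h1
  rw [key φ, h1]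

end ColumnExpectation

/-! ### Second moments of hollow Gram matrices. -/

section HollowMoments

variable {n : ℕ}

/-- The scaled hollow Gram matrix of the centred column with outcome `w`. -/
noncomputable def colMatrix (s : ℝ) (q : Fin n → ℝ) (w : Fin n → Bool) :
    Matrix (Fin n) (Fin n) ℝ :=
  s • hollow (vecMulVec (fun i => bernDev (q i) (w i)) fun i => bernDev (q i) (w i))

theorem colMatrix_apply (s : ℝ) (q : Fin n → ℝ) (w : Fin n → Bool) (i j : Fin n) :
    colMatrix s q w i j =
      if i = j then 0 else s * (bernDev (q i) (w i) * bernDev (q j) (w j)) := by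
  by_cases h : i = j
  · subst h; simp [colMatrix, hollow, vecMulVec_apply]
  · simp [colMatrix, hollow, vecMulVec_apply, h]

theorem colMatrix_isSymm (s : ℝ) (q : Fin n → ℝ) (w : Fin n → Bool) : (colMatrix s q w).IsSymm := by
  ext i j
  simp only [transpose_apply, colMatrix_apply, eq_comm (a := j), mul_comm (bernDev (q j) (w j))]

/-- An upper bound of the spectral norm of `colMatrix`. -/
noncomputable def colRadius (s : ℝ) (q : Fin n → ℝ) (w : Fin n → Bool) : ℝ :=
  |s| * ∑ i, bernDev (q i) (w i) ^ 2

theorem colRadius_nonneg (s : ℝ) (q : Fin n → ℝ) (w : Fin n → Bool) : 0 ≤ colRadius s q w := by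
  unfold colRadius; positivity

/-- The left side is the squared Frobenius norm s² ∑_{i≠j} x_i² x_j². Restoring the diagonal terms
completes the square, so the radius bounds every eigenvalue. -/
theorem trace_colMatrix_sq_le (s : ℝ) (q : Fin n → ℝ) (w : Fin n → Bool) :
    (colMatrix s q w * colMatrix s q w).trace ≤ colRadius s q w ^ 2 := by
  rw [colRadius, mul_pow, sq_abs, pow_two (∑ i, _), Finset.sum_mul_sum, Finset.mul_sum]
  simp only [trace, diag_apply, mul_apply, Finset.mul_sum]
  refine Finset.sum_le_sum fun i _ => Finset.sum_le_sum fun j _ => ?_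
  rw [colMatrix_apply, colMatrix_apply]
  by_cases h : i = j
  · simp only [h, if_true]
    rw [mul_zero]; positivity
  · rw [if_neg h, if_neg (Ne.symm h)]
    apply le_of_eq; ring

theorem colExp_dev_mul {q : Fin n → ℝ} {a : Fin n} {f : (Fin n → Bool) → ℝ}
    (hf : ∀ w x, f (Function.update w a x) = f w) :
    colExp q (fun w => bernDev (q a) (w a) * f w) = 0 := by
  rw [colExp_mul_of_indep q a (bernDev (q a)) f hf, bernExp_dev, zero_mul]

theorem colExp_colMatrix_apply (s : ℝ) (q : Fin n → ℝ) (i j : Fin n) :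
    colExp q (fun w => colMatrix s q w i j) = 0 := by
  by_cases h : i = j
  · simp [colMatrix_apply, h, colExp_const]
  · simp only [colMatrix_apply, if_neg h]
    rw [colExp_const_mul, colExp_dev_mul, mul_zero]
    intro w x
    rw [Function.update_of_ne (Ne.symm h)]

/-- Only the two pairings of the index pairs survive: an index occurring once factors out as a
centred variable, and hollowness removes i = j and k = l. -/
theorem colExp_colMatrix_mul (s : ℝ) (q : Fin n → ℝ) (i j k l : Fin n) :
    colExp q (fun w => colMatrix s q w i j * colMatrix s q w k l) =
      if i ≠ j ∧ (i = k ∧ j = l ∨ i = l ∧ j = k) then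
        s ^ 2 * (q i * (1 - q i) * (q j * (1 - q j))) else 0 := by
  have hsq : ∀ a b : Fin n, a ≠ b →
      colExp q (fun w => bernDev (q a) (w a) ^ 2 * bernDev (q b) (w b) ^ 2)
        = q a * (1 - q a) * (q b * (1 - q b)) := by
    intro a b hab
    rw [colExp_mul_of_indep q a (fun x => bernDev (q a) x ^ 2) _ fun w x => by
      rw [Function.update_of_ne hab.symm], bernExp_dev_sq]
    have := colExp_mul_of_indep q b (fun x => bernDev (q b) x ^ 2) (fun _ => 1) fun _ _ => rfl
    simp only [mul_one, colExp_const, bernExp_dev_sq] at this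
    rw [this]
  have hz : ∀ a b c d : Fin n, a ≠ b → a ≠ c → a ≠ d →
      colExp q (fun w => bernDev (q a) (w a) *
        (bernDev (q b) (w b) * bernDev (q c) (w c) * bernDev (q d) (w d))) = 0 := by
    intro a b c d hb hc hd
    refine colExp_dev_mul fun w x => ?_
    rw [Function.update_of_ne hb.symm, Function.update_of_ne hc.symm, Function.update_of_ne hd.symm]
  by_cases hij : i = j
  · simp [hij, colMatrix_apply, colExp_const]
  by_cases hkl : k = l
  · have : ¬ (i ≠ j ∧ (i = k ∧ j = l ∨ i = l ∧ j = k)) := by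
      rintro ⟨h, ⟨h1, h2⟩ | ⟨h1, h2⟩⟩ <;> exact h (by rw [h1, h2, hkl])
    rw [if_neg this]
    simp [hkl, colMatrix_apply, colExp_const]
  have hgen : colExp q (fun w => colMatrix s q w i j * colMatrix s q w k l) = s ^ 2 *
      colExp q (fun w => bernDev (q i) (w i) * bernDev (q j) (w j) *
        (bernDev (q k) (w k) * bernDev (q l) (w l))) := by
    rw [← colExp_const_mul]
    congr 1
    ext w
    rw [colMatrix_apply, colMatrix_apply, if_neg hij, if_neg hkl]
    ring
  rw [hgen]
  by_cases hik : i = k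
  · subst hik
    by_cases hjl : j = l
    · subst hjl
      rw [if_pos ⟨hij, Or.inl ⟨rfl, rfl⟩⟩, ← hsq i j hij]
      congr 2; ext w; ring
    · rw [if_neg (by rintro ⟨-, ⟨-, h⟩ | ⟨h, -⟩⟩; exacts [hjl h, hkl h])]
      rw [mul_eq_zero]; right
      rw [← hz j i i l (Ne.symm hij) (Ne.symm hij) hjl]
      congr 1; ext w; ring
  by_cases hil : i = l
  · subst hil
    by_cases hjk : j = k
    · subst hjk
      rw [if_pos ⟨hij, Or.inr ⟨rfl, rfl⟩⟩, ← hsq i j hij]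
      congr 2; ext w; ring
    · rw [if_neg (by rintro ⟨-, ⟨h, -⟩ | ⟨-, h⟩⟩; exacts [hik h, hjk h])]
      rw [mul_eq_zero]; right
      rw [← hz j i i k (Ne.symm hij) (Ne.symm hij) hjk]
      congr 1; ext w; ring
  · rw [if_neg (by rintro ⟨-, ⟨h, -⟩ | ⟨h, -⟩⟩; exacts [hik h, hil h])]
    rw [mul_eq_zero]; right
    rw [← hz i j k l hij hik hil]
    congr 1; ext w; ring

theorem colExp_trace_mul (s : ℝ) (q : Fin n → ℝ) (N : Matrix (Fin n) (Fin n) ℝ) :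
    colExp q (fun w => (N * colMatrix s q w).trace) = 0 := by
  simp only [trace, diag_apply, mul_apply, colExp_sum, colExp_const_mul, colExp_colMatrix_apply,
    mul_zero, Finset.sum_const_zero]

theorem colExp_trace_mul_sq (s : ℝ) (q : Fin n → ℝ) (N : Matrix (Fin n) (Fin n) ℝ) :
    colExp q (fun w => (N * (colMatrix s q w * colMatrix s q w)).trace) =
      s ^ 2 * ∑ i, N i i * (q i * (1 - q i)) * ∑ j, if i ≠ j then q j * (1 - q j) else 0 := by
  simp only [trace, diag_apply, mul_apply, colExp_sum, colExp_const_mul, colExp_colMatrix_mul,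
    Finset.mul_sum]
  refine Finset.sum_congr rfl fun i _ => ?_
  rw [Finset.sum_eq_single i]
  · refine Finset.sum_congr rfl fun j _ => ?_
    by_cases h : i = j
    · simp [h]
    · simp [h]; ring
  · intro k _ hk
    refine Finset.sum_eq_zero fun j _ => ?_
    rw [if_neg, mul_zero]
    rintro ⟨h, ⟨h1, h2⟩ | ⟨h1, -⟩⟩
    exacts [h h1, hk h1]
  · simp

theorem sum_sum_mul_ite_pair {a b : Fin n} (hab : a ≠ b) (G : Fin n → Fin n → ℝ) (c : ℝ) :
    ∑ k, ∑ l, G k l * (if a ≠ b ∧ (a = k ∧ b = l ∨ a = l ∧ b = k) then c else 0) =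
      (G a b + G b a) * c := by
  have e : ∀ k l, G k l * (if a ≠ b ∧ (a = k ∧ b = l ∨ a = l ∧ b = k) then c else 0) =
      (if a = k then if b = l then G k l * c else 0 else 0) +
        (if b = k then if a = l then G k l * c else 0 else 0) := by
    intro k l
    grind
  simp only [e, Finset.sum_add_distrib]
  simp
  ring

/-- One pairing gives products of diagonal entries, the source of (tr M)², and the other gives
squared entries, the source of tr M². -/
theorem colExp_trace_mul_mul (s : ℝ) (q : Fin n → ℝ) (M : Matrix (Fin n) (Fin n) ℝ) :
    colExp q (fun w => (M * colMatrix s q w * (M * colMatrix s q w)).trace) =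
      s ^ 2 * ∑ i, ∑ j, if i ≠ j then
        q i * (1 - q i) * (q j * (1 - q j)) * (M i i * M j j + M j i ^ 2) else 0 := by
  have e : ∀ w, (M * colMatrix s q w * (M * colMatrix s q w)).trace =
      ∑ j, ∑ k, ∑ l, ∑ i, M i j * M k l * (colMatrix s q w j k * colMatrix s q w l i) := by
    intro w
    simp only [trace, diag_apply, mul_apply (M := M * colMatrix s q w)]
    simp only [mul_apply, Finset.sum_mul_sum]
    have h1 : ∀ i k, ∑ j, ∑ l, M i j * colMatrix s q w j k * (M k l * colMatrix s q w l i) =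
      ∑ j, ∑ l, M i j * M k l * (colMatrix s q w j k * colMatrix s q w l i) := fun i k =>
      Finset.sum_congr rfl fun j _ => Finset.sum_congr rfl fun l _ => by ring
    simp only [h1]
    calc _ = ∑ i, ∑ j, ∑ k, ∑ l, M i j * M k l * (colMatrix s q w j k * colMatrix s q w l i) :=
          Finset.sum_congr rfl fun i _ => Finset.sum_comm
      _ = ∑ j, ∑ i, ∑ k, ∑ l, M i j * M k l * (colMatrix s q w j k * colMatrix s q w l i) :=
          Finset.sum_comm
      _ = ∑ j, ∑ k, ∑ i, ∑ l, M i j * M k l * (colMatrix s q w j k * colMatrix s q w l i) :=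
          Finset.sum_congr rfl fun j _ => Finset.sum_comm
      _ = _ := Finset.sum_congr rfl fun j _ => Finset.sum_congr rfl fun k _ => Finset.sum_comm
  simp only [e, colExp_sum, colExp_const_mul, colExp_colMatrix_mul, Finset.mul_sum]
  refine Finset.sum_congr rfl fun j _ => Finset.sum_congr rfl fun k _ => ?_
  by_cases hjk : j = k
  · simp [hjk]
  · rw [sum_sum_mul_ite_pair hjk fun l i => M i j * M k l, if_pos hjk]
    ring

theorem colExp_trace_mul_pow (s : ℝ) (q : Fin n → ℝ) (M : Matrix (Fin n) (Fin n) ℝ) :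
    colExp q (fun w => (M * colMatrix s q w).trace ^ 2) =
      s ^ 2 * ∑ i, ∑ j, if i ≠ j then
        q i * (1 - q i) * (q j * (1 - q j)) * (M j i * (M i j + M j i)) else 0 := by
  have e : ∀ w, (M * colMatrix s q w).trace ^ 2 =
      ∑ j, ∑ i, ∑ l, ∑ k, M i j * M k l * (colMatrix s q w j i * colMatrix s q w l k) := by
    intro w
    have h1 : (M * colMatrix s q w).trace = ∑ j, ∑ i, M i j * colMatrix s q w j i := by
      simp only [trace, diag_apply, mul_apply]; exact Finset.sum_comm
    rw [h1, pow_two]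
    simp only [Finset.sum_mul, Finset.mul_sum]
    refine Finset.sum_congr rfl fun j _ => Finset.sum_congr rfl fun i _ =>
      Finset.sum_congr rfl fun l _ => Finset.sum_congr rfl fun k _ => by ring
  simp only [e, colExp_sum, colExp_const_mul, colExp_colMatrix_mul, Finset.mul_sum]
  refine Finset.sum_congr rfl fun j _ => Finset.sum_congr rfl fun i _ => ?_
  by_cases hji : j = i
  · simp [hji]
  · rw [sum_sum_mul_ite_pair hji fun l k => M i j * M k l, if_pos hji]
    ring

end HollowMoments

end BSBM

namespace BSBM

open Matrix

/-! ### Scalar estimates for the third-order remainder. -/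

section ScalarEstimates

theorem exp_le_div {s : ℝ} (hs : 0 ≤ s) :
    Real.exp s * (1 - s ^ 2 / 6) ≤ 1 + s + s ^ 2 / 3 := by
  have := exp_sub_quadratic_le hs
  linarith

theorem exp_sub_one_le_four_thirds_mul {s : ℝ} (hs : 0 ≤ s) (hs1 : s ≤ 1 / 2) :
    Real.exp s - 1 ≤ 4 / 3 * s := by
  have h := exp_le_div hs
  have h1 : (0 : ℝ) < 1 - s ^ 2 / 6 := by nlinarith
  have h2 : 1 + s + s ^ 2 / 3 ≤ (1 + 4 / 3 * s) * (1 - s ^ 2 / 6) := by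
    nlinarith [mul_nonneg hs (sub_nonneg.2 hs1), mul_nonneg hs hs,
      mul_nonneg (mul_nonneg hs hs) (sub_nonneg.2 hs1)]
  have := le_of_mul_le_mul_right (h.trans h2) h1
  linarith

/-- With y = θ(1+L) ≤ 1/2 and e^θ − 1 ≤ 4θ/3, the first exponent is at most 2y and the second
summand is at most (32/9)y², leaving a polynomial inequality in y. The constant 3, divided by the 6
of the exponential remainder, becomes the κ/2 of the column step. -/
theorem third_order_scalar_le {θ L : ℝ} (hθ : 0 ≤ θ) (hL : 0 ≤ L) (hy : θ * (1 + L) ≤ 1 / 2) :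
    Real.exp (2 * θ + L * (Real.exp θ - 1)) - 1 +
        L * (Real.exp θ * (Real.exp θ - 1) ^ 2 * Real.exp (L * (Real.exp θ - 1))) ≤
      3 * (θ * (1 + L) / (1 - θ * (1 + L))) := by
  set y := θ * (1 + L) with hydef
  have hy0 : 0 ≤ y := by positivity
  have hθL : 0 ≤ θ * L := by positivity
  have hθy : θ ≤ y := by rw [hydef]; linarith
  have hLy : θ * L ≤ y := by rw [hydef]; linarith
  have he := exp_sub_one_le_four_thirds_mul hθ (by linarith)
  have he0 : 0 ≤ Real.exp θ - 1 := by linarith [Real.one_le_exp hθ]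
  have h1 : Real.exp (2 * θ + L * (Real.exp θ - 1)) ≤ Real.exp (2 * y) := by
    refine Real.exp_le_exp.2 ?_
    have := mul_le_mul_of_nonneg_left he hL
    rw [hydef]; nlinarith
  have h2 : Real.exp (2 * y) - 1 ≤ (2 * y + 2 * y ^ 2) * (1 + 2 / 5 * y) := by
    have h := exp_le_div (s := 2 * y) (by linarith)
    have h3 : (0 : ℝ) < 1 - (2 * y) ^ 2 / 6 := by nlinarith
    have h4 : 1 ≤ (1 + 2 / 5 * y) * (1 - (2 * y) ^ 2 / 6) := by
      nlinarith [mul_nonneg hy0 (sub_nonneg.2 hy), mul_nonneg (mul_nonneg hy0 hy0) (sub_nonneg.2 hy)]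
    have h5 : (Real.exp (2 * y) - 1) * (1 - (2 * y) ^ 2 / 6) ≤ 2 * y + 2 * y ^ 2 := by nlinarith
    have h6 : 2 * y + 2 * y ^ 2 ≤
        (2 * y + 2 * y ^ 2) * (1 + 2 / 5 * y) * (1 - (2 * y) ^ 2 / 6) := by
      have : 0 ≤ 2 * y + 2 * y ^ 2 := by positivity
      nlinarith
    exact le_of_mul_le_mul_right (h5.trans h6) h3
  have h3 : Real.exp θ * Real.exp (L * (Real.exp θ - 1)) ≤ 2 := by
    rw [← Real.exp_add]
    have ha : θ + L * (Real.exp θ - 1) ≤ 2 / 3 := by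
      have := mul_le_mul_of_nonneg_left he hL
      nlinarith
    refine (Real.exp_le_exp.2 ha).trans ?_
    have := exp_le_div (s := 2 / 3) (by norm_num)
    norm_num at this
    linarith
  have h4 : L * (Real.exp θ - 1) ^ 2 ≤ 16 / 9 * y ^ 2 := by
    calc L * (Real.exp θ - 1) ^ 2 ≤ L * (4 / 3 * θ) ^ 2 := by gcongr
      _ = 16 / 9 * ((θ * L) * θ) := by ring
      _ ≤ 16 / 9 * (y * y) := by gcongr
      _ = _ := by ring
  have h5 : L * (Real.exp θ * (Real.exp θ - 1) ^ 2 * Real.exp (L * (Real.exp θ - 1)))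
      ≤ 32 / 9 * y ^ 2 := by
    calc _ = L * (Real.exp θ - 1) ^ 2 * (Real.exp θ * Real.exp (L * (Real.exp θ - 1))) := by ring
      _ ≤ 16 / 9 * y ^ 2 * 2 := by gcongr
      _ = _ := by ring
  have h6 : (2 * y + 2 * y ^ 2) * (1 + 2 / 5 * y) + 32 / 9 * y ^ 2 ≤ 3 * (y / (1 - y)) := by
    rw [← mul_div_assoc, le_div_iff₀ (by linarith)]
    have : ((2 + 2 * y) * (1 + 2 / 5 * y) + 32 / 9 * y) * (1 - y) ≤ 3 := by
      nlinarith [sq_nonneg (y - 2 / 5), mul_nonneg hy0 (sq_nonneg y)]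
    nlinarith
  linarith

end ScalarEstimates

/-! ### The third-order remainder in expectation. -/

section ThirdOrder

variable {n : ℕ} {q : Fin n → ℝ} {v : ℝ}

theorem colExp_prod_exp_le (h0 : ∀ i, 0 ≤ q i) (h1 : ∀ i, q i ≤ 1)
    (hv : ∀ i, q i * (1 - q i) ≤ v) {θ : ℝ} (hθ : 0 ≤ θ) (T : Finset (Fin n)) :
    0 ≤ colExp q (fun w => ∏ a ∈ T, Real.exp (θ * bernDev (q a) (w a) ^ 2)) ∧
    colExp q (fun w => ∏ a ∈ T, Real.exp (θ * bernDev (q a) (w a) ^ 2)) ≤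
      Real.exp (n * v * (Real.exp θ - 1)) := by
  have he0 : 0 ≤ Real.exp θ - 1 := by linarith [Real.one_le_exp hθ]
  refine ⟨Finset.sum_nonneg fun w _ => mul_nonneg (Finset.prod_nonneg fun i _ =>
    bernWeight_nonneg (h0 i) (h1 i) _) (Finset.prod_nonneg fun i _ => (Real.exp_pos _).le), ?_⟩
  have hb : ∀ i, bernExp (q i) (fun x => if i ∈ T then Real.exp (θ * bernDev (q i) x ^ 2) else 1)
      ≤ Real.exp (v * (Real.exp θ - 1)) := by
    intro i
    have hv0 : 0 ≤ v := le_trans (mul_nonneg (h0 i) (sub_nonneg.2 (h1 i))) (hv i)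
    by_cases hi : i ∈ T
    · simp only [hi, if_true]
      refine (bernExp_exp_le (h0 i) (h1 i)).trans (Real.exp_le_exp.2 ?_)
      exact mul_le_mul_of_nonneg_right (hv i) he0
    · simp only [hi, if_false, bernExp_eq]
      have : 1 ≤ Real.exp (v * (Real.exp θ - 1)) := Real.one_le_exp (by positivity)
      linarith
  calc _ = colExp q (fun w => ∏ i, if i ∈ T then Real.exp (θ * bernDev (q i) (w i) ^ 2) else 1) := by
        congr 1; ext w; rw [Finset.prod_ite_mem, Finset.univ_inter]
    _ = ∏ i, bernExp (q i) (fun x => if i ∈ T then Real.exp (θ * bernDev (q i) x ^ 2) else 1) :=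
        colExp_prod q fun i x => if i ∈ T then Real.exp (θ * bernDev (q i) x ^ 2) else 1
    _ ≤ ∏ _i : Fin n, Real.exp (v * (Real.exp θ - 1)) := by
        refine Finset.prod_le_prod (fun i _ => ?_) fun i _ => hb i
        refine Finset.sum_nonneg fun x _ => mul_nonneg (bernWeight_nonneg (h0 i) (h1 i) x) ?_
        split_ifs <;> positivity
    _ = _ := by
        rw [Finset.prod_const, Finset.card_univ, Fintype.card_fin, ← Real.exp_nat_mul]
        ring_nf

theorem exp_colRadius (s : ℝ) (q : Fin n → ℝ) (w : Fin n → Bool) :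
    Real.exp (colRadius s q w) = ∏ a, Real.exp (|s| * bernDev (q a) (w a) ^ 2) := by
  rw [colRadius, Finset.mul_sum, Real.exp_sum]

theorem prod_update_of_notMem {T : Finset (Fin n)} {a : Fin n} (ha : a ∉ T) (θ : ℝ)
    (w : Fin n → Bool) (x : Bool) :
    ∏ i ∈ T, Real.exp (θ * bernDev (q i) (Function.update w a x i) ^ 2) =
      ∏ i ∈ T, Real.exp (θ * bernDev (q i) (w i) ^ 2) :=
  Finset.prod_congr rfl fun i hi => by
    rw [Function.update_of_ne (ne_of_mem_of_not_mem hi ha)]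

/-- The weight exp(`colRadius`) factorises over coordinates: k and l cost at most e^θ each and all
the others together at most exp(nv(e^θ−1)). Subtracting the unweighted moment leaves the relative
excess. -/
theorem colExp_exp_mul_sq_mul_sq_le (h0 : ∀ i, 0 ≤ q i) (h1 : ∀ i, q i ≤ 1)
    (hv : ∀ i, q i * (1 - q i) ≤ v) (s : ℝ) {k l : Fin n} (hkl : k ≠ l) :
    colExp q (fun w => (Real.exp (colRadius s q w) - 1) *
        (bernDev (q k) (w k) ^ 2 * bernDev (q l) (w l) ^ 2)) ≤
      v ^ 2 * (Real.exp (2 * |s| + n * v * (Real.exp |s| - 1)) - 1) := by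
  set θ := |s| with hθdef
  have hθ : 0 ≤ θ := abs_nonneg s
  have hv0 : 0 ≤ v := le_trans (mul_nonneg (h0 k) (sub_nonneg.2 (h1 k))) (hv k)
  have he0 : 0 ≤ Real.exp θ - 1 := by linarith [Real.one_le_exp hθ]
  set X : Fin n → Bool → ℝ := fun i x => Real.exp (θ * bernDev (q i) x ^ 2) with hX
  set T : Finset (Fin n) := (Finset.univ.erase k).erase l with hT
  have hsplit : ∀ w : Fin n → Bool, Real.exp (colRadius s q w) *
      (bernDev (q k) (w k) ^ 2 * bernDev (q l) (w l) ^ 2) =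
      (bernDev (q k) (w k) ^ 2 * X k (w k)) * ((bernDev (q l) (w l) ^ 2 * X l (w l)) *
        ∏ a ∈ T, X a (w a)) := by
    intro w
    rw [exp_colRadius, ← Finset.mul_prod_erase _ _ (Finset.mem_univ k),
      ← Finset.mul_prod_erase _ _ (Finset.mem_erase.2 ⟨hkl.symm, Finset.mem_univ l⟩)]
    ring
  have hkT : k ∉ T := by simp [hT]
  have hlT : l ∉ T := by simp [hT]
  have e1 : colExp q (fun w => Real.exp (colRadius s q w) *
      (bernDev (q k) (w k) ^ 2 * bernDev (q l) (w l) ^ 2)) =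
      bernExp (q k) (fun x => bernDev (q k) x ^ 2 * X k x) *
        (bernExp (q l) (fun x => bernDev (q l) x ^ 2 * X l x) *
          colExp q (fun w => ∏ a ∈ T, X a (w a))) := by
    simp only [hsplit]
    rw [colExp_mul_of_indep q k (fun x => bernDev (q k) x ^ 2 * X k x) _ fun w x => by
      rw [Function.update_of_ne hkl.symm, prod_update_of_notMem hkT],
      colExp_mul_of_indep q l (fun x => bernDev (q l) x ^ 2 * X l x) _ fun w x =>
        prod_update_of_notMem hlT _ _ _]
  have e2 : colExp q (fun w => bernDev (q k) (w k) ^ 2 * bernDev (q l) (w l) ^ 2) =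
      q k * (1 - q k) * (q l * (1 - q l)) := by
    rw [colExp_mul_of_indep q k (fun x => bernDev (q k) x ^ 2) _ fun w x => by
      rw [Function.update_of_ne hkl.symm], bernExp_dev_sq]
    have := colExp_mul_of_indep q l (fun x => bernDev (q l) x ^ 2) (fun _ => 1) fun _ _ => rfl
    simp only [mul_one, colExp_const, bernExp_dev_sq] at this
    rw [this]
  simp only [sub_mul, one_mul]
  rw [colExp_sub, e1, e2]
  have hP := colExp_prod_exp_le h0 h1 hv hθ T
  have hk := bernExp_sq_mul_exp_le (h0 k) (h1 k) hθ
  have hl := bernExp_sq_mul_exp_le (h0 l) (h1 l) hθ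
  have hl0 := bernExp_sq_mul_exp_nonneg (θ := θ) (h0 l) (h1 l)
  have hvk : 0 ≤ q k * (1 - q k) := mul_nonneg (h0 k) (sub_nonneg.2 (h1 k))
  have hvl : 0 ≤ q l * (1 - q l) := mul_nonneg (h0 l) (sub_nonneg.2 (h1 l))
  have hD : 0 ≤ Real.exp (2 * θ + n * v * (Real.exp θ - 1)) - 1 := by
    rw [sub_nonneg]
    exact Real.one_le_exp (by positivity)
  calc _ ≤ q k * (1 - q k) * Real.exp θ * (q l * (1 - q l) * Real.exp θ *
        Real.exp (n * v * (Real.exp θ - 1))) - q k * (1 - q k) * (q l * (1 - q l)) := by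
        refine sub_le_sub_right ?_ _
        refine mul_le_mul hk (mul_le_mul hl hP.2 hP.1 (by positivity)) (mul_nonneg hl0 hP.1)
          (by positivity)
    _ = q k * (1 - q k) * (q l * (1 - q l)) *
        (Real.exp (2 * θ + n * v * (Real.exp θ - 1)) - 1) := by
        rw [Real.exp_add, two_mul, Real.exp_add]; ring
    _ ≤ v * v * (Real.exp (2 * θ + n * v * (Real.exp θ - 1)) - 1) := by
        have := mul_le_mul (hv k) (hv l) hvl hv0
        gcongr
    _ = _ := by ring

/-- The coordinates i and k occur to the first power, so each contributes a factor e^θ − 1. Without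
the exponential weight the mean is zero. -/
theorem abs_colExp_exp_mul_le (h0 : ∀ i, 0 ≤ q i) (h1 : ∀ i, q i ≤ 1)
    (hv : ∀ i, q i * (1 - q i) ≤ v) (s : ℝ) {i k l : Fin n} (hkl : k ≠ l) (hil : i ≠ l)
    (hik : i ≠ k) :
    |colExp q (fun w => (Real.exp (colRadius s q w) - 1) *
        (bernDev (q i) (w i) * (bernDev (q k) (w k) * bernDev (q l) (w l) ^ 2)))| ≤
      v ^ 3 * (Real.exp |s| * (Real.exp |s| - 1) ^ 2 *
        Real.exp (n * v * (Real.exp |s| - 1))) := by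
  set θ := |s| with hθdef
  have hθ : 0 ≤ θ := abs_nonneg s
  have hv0 : 0 ≤ v := le_trans (mul_nonneg (h0 k) (sub_nonneg.2 (h1 k))) (hv k)
  have he0 : 0 ≤ Real.exp θ - 1 := by linarith [Real.one_le_exp hθ]
  set X : Fin n → Bool → ℝ := fun i x => Real.exp (θ * bernDev (q i) x ^ 2) with hX
  set T : Finset (Fin n) := ((Finset.univ.erase i).erase k).erase l with hT
  have hsplit : ∀ w : Fin n → Bool, Real.exp (colRadius s q w) *
      (bernDev (q i) (w i) * (bernDev (q k) (w k) * bernDev (q l) (w l) ^ 2)) =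
      (bernDev (q i) (w i) * X i (w i)) * ((bernDev (q k) (w k) * X k (w k)) *
        ((bernDev (q l) (w l) ^ 2 * X l (w l)) * ∏ a ∈ T, X a (w a))) := by
    intro w
    rw [exp_colRadius, ← Finset.mul_prod_erase _ _ (Finset.mem_univ i),
      ← Finset.mul_prod_erase _ _ (Finset.mem_erase.2 ⟨hik.symm, Finset.mem_univ k⟩),
      ← Finset.mul_prod_erase _ _ (Finset.mem_erase.2 ⟨hkl.symm, Finset.mem_erase.2
        ⟨hil.symm, Finset.mem_univ l⟩⟩)]
    ring
  have hiT : i ∉ T := by simp [hT]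
  have hkT : k ∉ T := by simp [hT]
  have hlT : l ∉ T := by simp [hT]
  have e1 : colExp q (fun w => Real.exp (colRadius s q w) *
      (bernDev (q i) (w i) * (bernDev (q k) (w k) * bernDev (q l) (w l) ^ 2))) =
      bernExp (q i) (fun x => bernDev (q i) x * X i x) *
        (bernExp (q k) (fun x => bernDev (q k) x * X k x) *
        (bernExp (q l) (fun x => bernDev (q l) x ^ 2 * X l x) *
          colExp q (fun w => ∏ a ∈ T, X a (w a)))) := by
    simp only [hsplit]
    rw [colExp_mul_of_indep q i (fun x => bernDev (q i) x * X i x) _ fun w x => by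
        rw [Function.update_of_ne hik.symm, Function.update_of_ne hil.symm,
          prod_update_of_notMem hiT],
      colExp_mul_of_indep q k (fun x => bernDev (q k) x * X k x) _ fun w x => by
        rw [Function.update_of_ne hkl.symm, prod_update_of_notMem hkT],
      colExp_mul_of_indep q l (fun x => bernDev (q l) x ^ 2 * X l x) _ fun w x =>
        prod_update_of_notMem hlT _ _ _]
  have e2 : colExp q (fun w =>
      bernDev (q i) (w i) * (bernDev (q k) (w k) * bernDev (q l) (w l) ^ 2)) = 0 :=
    colExp_dev_mul fun w x => by
      rw [Function.update_of_ne hik.symm, Function.update_of_ne hil.symm]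
  simp only [sub_mul, one_mul]
  rw [colExp_sub, e1, e2, sub_zero]
  have hP := colExp_prod_exp_le h0 h1 hv hθ T
  have hi := abs_bernExp_mul_exp_le (h0 i) (h1 i) hθ
  have hk := abs_bernExp_mul_exp_le (h0 k) (h1 k) hθ
  have hl := bernExp_sq_mul_exp_le (h0 l) (h1 l) hθ
  have hl0 := bernExp_sq_mul_exp_nonneg (θ := θ) (h0 l) (h1 l)
  rw [abs_mul, abs_mul, abs_mul, abs_of_nonneg hl0, abs_of_nonneg hP.1]
  calc _ ≤ v * (Real.exp θ - 1) * (v * (Real.exp θ - 1) * (v * Real.exp θ *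
        Real.exp (n * v * (Real.exp θ - 1)))) := by
        have hi' := hi.trans (mul_le_mul_of_nonneg_right (hv i) he0)
        have hk' := hk.trans (mul_le_mul_of_nonneg_right (hv k) he0)
        have hl' := hl.trans (mul_le_mul_of_nonneg_right (hv l) (Real.exp_pos θ).le)
        exact mul_le_mul hi' (mul_le_mul hk' (mul_le_mul hl' hP.2 hP.1 (by positivity))
          (mul_nonneg hl0 hP.1) (by positivity))
          (mul_nonneg (abs_nonneg _) (mul_nonneg hl0 hP.1)) (by positivity)
    _ = _ := by ring

theorem abs_mul_self_apply_le {B : Matrix (Fin n) (Fin n) ℝ} (hB : B.IsSymm) (i k : Fin n) :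
    |(B * B) i k| ≤ ((B * B) i i + (B * B) k k) / 2 := by
  simp only [mul_apply, ← Finset.sum_add_distrib, Finset.sum_div]
  refine (Finset.abs_sum_le_sum_abs _ _).trans (Finset.sum_le_sum fun j _ => ?_)
  rw [hB.apply i j, hB.apply k j, abs_mul]
  nlinarith [sq_nonneg (|B i j| - |B k j|), sq_abs (B i j), sq_abs (B k j)]

theorem mul_self_apply_self_nonneg {B : Matrix (Fin n) (Fin n) ℝ} (hB : B.IsSymm) (i : Fin n) :
    0 ≤ (B * B) i i := by
  simp only [mul_apply]
  refine Finset.sum_nonneg fun j _ => ?_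
  rw [hB.apply i j]
  exact mul_self_nonneg _

/-- Writing the weight matrix as B² makes it positive semidefinite, so its off-diagonal entries are
controlled by diagonal ones and everything is bounded by its trace. The n² diagonal terms and n³
off-diagonal terms combine, the extra n being matched by an extra v. -/
theorem colExp_third_order_le (h0 : ∀ i, 0 ≤ q i) (h1 : ∀ i, q i ≤ 1)
    (hv : ∀ i, q i * (1 - q i) ≤ v) (hv0 : 0 ≤ v) {s : ℝ} (hs : |s| * (1 + n * v) ≤ 1 / 2)
    {B : Matrix (Fin n) (Fin n) ℝ} (hB : B.IsSymm) :
    colExp q (fun w => (Real.exp (colRadius s q w) - 1) *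
        (B * B * (colMatrix s q w * colMatrix s q w)).trace) ≤
      3 * (s ^ 2 * v ^ 2) * n * (|s| * (1 + n * v) / (1 - |s| * (1 + n * v))) *
        (B * B).trace := by
  set N := B * B with hN
  set θ := |s| with hθdef
  have hθ : 0 ≤ θ := abs_nonneg s
  have he0 : 0 ≤ Real.exp θ - 1 := by linarith [Real.one_le_exp hθ]
  set D₁ := Real.exp (2 * θ + n * v * (Real.exp θ - 1)) - 1 with hD₁
  set D₂ := Real.exp θ * (Real.exp θ - 1) ^ 2 * Real.exp (n * v * (Real.exp θ - 1)) with hD₂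
  have hD₁0 : 0 ≤ D₁ := by
    rw [hD₁, sub_nonneg]
    exact Real.one_le_exp (by positivity)
  have hD₂0 : 0 ≤ D₂ := by positivity
  have hN0 : ∀ i, 0 ≤ N i i := mul_self_apply_self_nonneg hB
  have hterm : ∀ i k l, N i k * colExp q (fun w => (Real.exp (colRadius s q w) - 1) *
      (colMatrix s q w k l * colMatrix s q w l i)) ≤
      (if i = k then s ^ 2 * v ^ 2 * D₁ * N i i else 0) +
        s ^ 2 * v ^ 3 * D₂ * ((N i i + N k k) / 2) := by
    intro i k l
    have hpos2 : 0 ≤ s ^ 2 * v ^ 3 * D₂ * ((N i i + N k k) / 2) := by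
      have := hN0 i
      have := hN0 k
      positivity
    have hpos1 : 0 ≤ (if i = k then s ^ 2 * v ^ 2 * D₁ * N i i else 0) := by
      have := hN0 i
      split_ifs <;> positivity
    by_cases hkl : k = l
    · simp only [colMatrix_apply, hkl, if_true, zero_mul, mul_zero, colExp_const]
      rw [hkl] at hpos1 hpos2
      exact add_nonneg hpos1 hpos2
    by_cases hil : i = l
    · simp only [colMatrix_apply, hil, if_true, mul_zero, colExp_const]
      rw [hil] at hpos1 hpos2
      exact add_nonneg hpos1 hpos2
    have hli : ¬ l = i := fun h => hil h.symm
    by_cases hik : i = k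
    · subst hik
      have e : colExp q (fun w => (Real.exp (colRadius s q w) - 1) *
          (colMatrix s q w i l * colMatrix s q w l i)) = s ^ 2 * colExp q (fun w =>
          (Real.exp (colRadius s q w) - 1) *
            (bernDev (q i) (w i) ^ 2 * bernDev (q l) (w l) ^ 2)) := by
        rw [← colExp_const_mul]
        congr 1; ext w
        rw [colMatrix_apply, colMatrix_apply, if_neg hil, if_neg hli]; ring
      rw [e, if_pos rfl]
      have := colExp_exp_mul_sq_mul_sq_le h0 h1 hv s hil
      calc _ ≤ N i i * (s ^ 2 * (v ^ 2 * D₁)) := by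
            have := hN0 i
            gcongr
        _ ≤ _ := by linarith
    · have e : colExp q (fun w => (Real.exp (colRadius s q w) - 1) *
          (colMatrix s q w k l * colMatrix s q w l i)) = s ^ 2 * colExp q (fun w =>
          (Real.exp (colRadius s q w) - 1) *
            (bernDev (q i) (w i) * (bernDev (q k) (w k) * bernDev (q l) (w l) ^ 2))) := by
        rw [← colExp_const_mul]
        congr 1; ext w
        rw [colMatrix_apply, colMatrix_apply, if_neg hkl, if_neg hli]; ring
      rw [e, if_neg hik, zero_add]
      have hE := abs_colExp_exp_mul_le h0 h1 hv s hkl hil hik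
      have hNik := abs_mul_self_apply_le hB i k
      calc _ ≤ |N i k| * (s ^ 2 * |colExp q (fun w => (Real.exp (colRadius s q w) - 1) *
            (bernDev (q i) (w i) * (bernDev (q k) (w k) * bernDev (q l) (w l) ^ 2)))|) := by
            refine (le_abs_self _).trans_eq ?_
            rw [abs_mul, abs_mul, abs_of_nonneg (sq_nonneg s)]
        _ ≤ (N i i + N k k) / 2 * (s ^ 2 * (v ^ 3 * D₂)) := by
            refine mul_le_mul hNik (mul_le_mul_of_nonneg_left hE (sq_nonneg s)) (by positivity) ?_
            linarith [hN0 i, hN0 k]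
        _ = _ := by ring
  have hexpand : colExp q (fun w => (Real.exp (colRadius s q w) - 1) *
      (N * (colMatrix s q w * colMatrix s q w)).trace) =
      ∑ i, ∑ k, ∑ l, N i k * colExp q (fun w => (Real.exp (colRadius s q w) - 1) *
        (colMatrix s q w k l * colMatrix s q w l i)) := by
    simp only [← colExp_const_mul, ← colExp_sum]
    congr 1; ext w
    simp only [trace, diag_apply, mul_apply (M := N), mul_apply (M := colMatrix s q w),
      Finset.mul_sum]
    exact Finset.sum_congr rfl fun i _ => Finset.sum_congr rfl fun k _ =>
      Finset.sum_congr rfl fun l _ => by ring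
  rw [hexpand]
  have htr : ∑ i, N i i = N.trace := rfl
  have htr0 : 0 ≤ N.trace := Finset.sum_nonneg fun i _ => hN0 i
  calc _ ≤ ∑ i, ∑ k, ∑ _l : Fin n, ((if i = k then s ^ 2 * v ^ 2 * D₁ * N i i else 0) +
        s ^ 2 * v ^ 3 * D₂ * ((N i i + N k k) / 2)) :=
        Finset.sum_le_sum fun i _ => Finset.sum_le_sum fun k _ =>
          Finset.sum_le_sum fun l _ => hterm i k l
    _ = s ^ 2 * v ^ 2 * n * (D₁ + n * v * D₂) * N.trace := by
        simp only [Finset.sum_const, Finset.card_univ, Fintype.card_fin, nsmul_eq_mul, mul_add,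
          Finset.sum_add_distrib, ← Finset.mul_sum, ← Finset.sum_div, Finset.sum_ite_eq,
          Finset.mem_univ, if_true, htr]
        ring
    _ ≤ s ^ 2 * v ^ 2 * n * (3 * (θ * (1 + n * v) / (1 - θ * (1 + n * v)))) * N.trace := by
        have := third_order_scalar_le hθ (by positivity : 0 ≤ n * v) hs
        gcongr
    _ = _ := by ring

end ThirdOrder

end BSBM

namespace BSBM

open Matrix

/-! ### Adding one column. -/

section ColumnStep

variable {n : ℕ} {q : Fin n → ℝ} {v : ℝ}

theorem sum_ne_le (hv : ∀ i, q i * (1 - q i) ≤ v) (i : Fin n) :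
    ∑ j, (if i ≠ j then q j * (1 - q j) else 0) ≤ (n - 1) * v := by
  calc _ = ∑ j ∈ Finset.univ.erase i, q j * (1 - q j) := by
        rw [← Finset.sum_filter]
        congr 1
        ext j; simp [eq_comm]
    _ ≤ ∑ _j ∈ Finset.univ.erase i, v := Finset.sum_le_sum fun j _ => hv j
    _ = _ := by
        have : 1 ≤ n := i.pos
        simp [Nat.cast_sub this]

theorem colExp_trace_mul_sq_le (h0 : ∀ i, 0 ≤ q i) (h1 : ∀ i, q i ≤ 1)
    (hv : ∀ i, q i * (1 - q i) ≤ v) (hv0 : 0 ≤ v) (s : ℝ) {N : Matrix (Fin n) (Fin n) ℝ}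
    (hN : ∀ i, 0 ≤ N i i) :
    colExp q (fun w => (N * (colMatrix s q w * colMatrix s q w)).trace) ≤
      s ^ 2 * v ^ 2 * (n - 1) * N.trace := by
  rw [colExp_trace_mul_sq, trace, Finset.mul_sum, Finset.mul_sum]
  refine Finset.sum_le_sum fun i _ => ?_
  have h := sum_ne_le hv i
  have hn : (1 : ℝ) ≤ n := by exact_mod_cast i.pos
  have hs0 : 0 ≤ ∑ j, (if i ≠ j then q j * (1 - q j) else 0) :=
    Finset.sum_nonneg fun j _ => by
      have := mul_nonneg (h0 j) (sub_nonneg.2 (h1 j))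
      split_ifs <;> simp [this]
  calc _ ≤ s ^ 2 * (N i i * v * ((n - 1) * v)) := by
        have h2 := hN i
        have h3 := hv i
        have h4 : 0 ≤ N i i * v := mul_nonneg h2 hv0
        gcongr
    _ = _ := by rw [diag_apply]; ring

theorem sum_sum_ne_mul_le (h0 : ∀ i, 0 ≤ q i) (h1 : ∀ i, q i ≤ 1)
    (hv : ∀ i, q i * (1 - q i) ≤ v) (F : Fin n → Fin n → ℝ) (hF : ∀ i j, 0 ≤ F i j) :
    ∑ i, ∑ j, (if i ≠ j then q i * (1 - q i) * (q j * (1 - q j)) * F i j else 0) ≤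
      v ^ 2 * (∑ i, ∑ j, F i j - ∑ i, F i i) := by
  have e : v ^ 2 * (∑ i, ∑ j, F i j - ∑ i, F i i) =
      ∑ i, ∑ j, if i ≠ j then v ^ 2 * F i j else 0 := by
    have h : ∀ i j, (if i ≠ j then v ^ 2 * F i j else 0) =
        v ^ 2 * F i j - if i = j then v ^ 2 * F i j else 0 := by
      intro i j; by_cases h : i = j <;> simp [h]
    simp only [h, Finset.sum_sub_distrib, Finset.sum_ite_eq, Finset.mem_univ, if_true,
      ← Finset.mul_sum]
    ring
  rw [e]
  refine Finset.sum_le_sum fun i _ => Finset.sum_le_sum fun j _ => ?_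
  split_ifs with h
  · have hi := mul_nonneg (h0 i) (sub_nonneg.2 (h1 i))
    have hj := mul_nonneg (h0 j) (sub_nonneg.2 (h1 j))
    rw [pow_two]
    have := mul_le_mul (hv i) (hv j) hj (hi.trans (hv i))
    exact mul_le_mul_of_nonneg_right this (hF i j)
  · rfl

theorem trace_mul_self_of_isSymm {M : Matrix (Fin n) (Fin n) ℝ} (hM : M.IsSymm) :
    (M * M).trace = ∑ i, ∑ j, M j i ^ 2 := by
  simp only [trace, diag_apply, mul_apply]
  refine Finset.sum_congr rfl fun i _ => Finset.sum_congr rfl fun j _ => ?_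
  rw [hM.apply j i, pow_two]

theorem trace_sq_eq_sum (M : Matrix (Fin n) (Fin n) ℝ) :
    M.trace ^ 2 = ∑ i, ∑ j, M i i * M j j := by
  rw [pow_two, trace, Finset.sum_mul_sum]; rfl

theorem trace_sq_le_mul_sum (M : Matrix (Fin n) (Fin n) ℝ) :
    M.trace ^ 2 ≤ n * ∑ i, M i i ^ 2 := by
  simpa [trace] using sq_sum_le_card_mul_sum_sq (s := Finset.univ) (f := fun i => M i i)

/-- Omitting i = j removes 2∑M_ii² from the two pairings, and Cauchy–Schwarz turns this into the
gain (2/n)(tr M)². The same gain occurs in `colExp_trace_mul_pow_le`. -/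
theorem colExp_trace_mul_mul_le (h0 : ∀ i, 0 ≤ q i) (h1 : ∀ i, q i ≤ 1)
    (hv : ∀ i, q i * (1 - q i) ≤ v) (hn : 0 < n) (s : ℝ)
    {M : Matrix (Fin n) (Fin n) ℝ} (hM : M.IsSymm) (hM0 : ∀ i, 0 ≤ M i i) :
    colExp q (fun w => (M * colMatrix s q w * (M * colMatrix s q w)).trace) ≤
      s ^ 2 * v ^ 2 * ((1 - 2 / n) * M.trace ^ 2 + (M * M).trace) := by
  rw [colExp_trace_mul_mul, mul_assoc]
  refine mul_le_mul_of_nonneg_left ?_ (sq_nonneg s)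
  refine (sum_sum_ne_mul_le h0 h1 hv (fun i j => M i i * M j j + M j i ^ 2) fun i j =>
    add_nonneg (mul_nonneg (hM0 i) (hM0 j)) (sq_nonneg _)).trans ?_
  refine mul_le_mul_of_nonneg_left ?_ (sq_nonneg v)
  have e : ∀ i, M i i * M i i = M i i ^ 2 := fun i => (pow_two _).symm
  simp only [Finset.sum_add_distrib, e]
  rw [← trace_sq_eq_sum, ← trace_mul_self_of_isSymm hM]
  have h := trace_sq_le_mul_sum M
  have hn' : (0 : ℝ) < n := by exact_mod_cast hn
  have h2 : 2 / n * M.trace ^ 2 ≤ 2 * ∑ i, M i i ^ 2 := by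
    rw [div_mul_eq_mul_div, div_le_iff₀ hn']; linarith
  linarith

theorem colExp_trace_mul_pow_le (h0 : ∀ i, 0 ≤ q i) (h1 : ∀ i, q i ≤ 1)
    (hv : ∀ i, q i * (1 - q i) ≤ v) (hn : 0 < n) (s : ℝ)
    {M : Matrix (Fin n) (Fin n) ℝ} (hM : M.IsSymm) :
    colExp q (fun w => (M * colMatrix s q w).trace ^ 2) ≤
      s ^ 2 * v ^ 2 * (2 * (M * M).trace - 2 / n * M.trace ^ 2) := by
  rw [colExp_trace_mul_pow, mul_assoc]
  refine mul_le_mul_of_nonneg_left ?_ (sq_nonneg s)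
  have e : ∀ i j, M j i * (M i j + M j i) = 2 * M j i ^ 2 := by
    intro i j; rw [hM.apply j i]; ring
  simp only [e]
  refine (sum_sum_ne_mul_le h0 h1 hv (fun i j => 2 * M j i ^ 2) fun i j => by positivity).trans ?_
  refine mul_le_mul_of_nonneg_left ?_ (sq_nonneg v)
  simp only [← Finset.mul_sum]
  rw [← trace_mul_self_of_isSymm hM]
  have h := trace_sq_le_mul_sum M
  have hn' : (0 : ℝ) < n := by exact_mod_cast hn
  have h2 : 2 / n * M.trace ^ 2 ≤ 2 * ∑ i, M i i ^ 2 := by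
    rw [div_mul_eq_mul_div, div_le_iff₀ hn']; linarith
  linarith

/-- The coefficient n/4 is (n−1)/4 from tr(M²Z²) plus 1/4 from tr(MZMZ). The other part of tr(MZMZ)
brings in (tr e^(Y/2))², which must therefore be propagated as well. -/
theorem colExp_trace_exp_add_le (h0 : ∀ i, 0 ≤ q i) (h1 : ∀ i, q i ≤ 1)
    (hv : ∀ i, q i * (1 - q i) ≤ v) (hv0 : 0 ≤ v) (hn : 0 < n) {s κ : ℝ}
    (hs : |s| * (1 + n * v) ≤ 1 / 2)
    (hκ : κ = |s| * (1 + n * v) / (1 - |s| * (1 + n * v)))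
    {Y : Matrix (Fin n) (Fin n) ℝ} (hY : Y.IsSymm) :
    colExp q (fun w => (NormedSpace.exp (Y + colMatrix s q w)).trace) ≤
      (1 + s ^ 2 * v ^ 2 * n / 4 + s ^ 2 * v ^ 2 * n * κ / 2) * (NormedSpace.exp Y).trace +
        s ^ 2 * v ^ 2 / 4 * (1 - 2 / n) * (NormedSpace.exp ((2 : ℝ)⁻¹ • Y)).trace ^ 2 := by
  have : Nonempty (Fin n) := ⟨⟨0, hn⟩⟩
  obtain ⟨M, hM⟩ : ∃ M, M = NormedSpace.exp ((2 : ℝ)⁻¹ • Y) := ⟨_, rfl⟩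
  have hMs : M.IsSymm := hM ▸ isSymm_exp (hY.smul _)
  obtain ⟨B, hB⟩ : ∃ B, B = NormedSpace.exp ((2 : ℝ)⁻¹ • (2 : ℝ)⁻¹ • Y) := ⟨_, rfl⟩
  have hBs : B.IsSymm := hB ▸ isSymm_exp ((hY.smul _).smul _)
  have hBM : B * B = M := by rw [hB, ← pow_two, exp_inv_two_smul_sq, hM]
  have hM0 : ∀ i, 0 ≤ M i i := fun i => by rw [← hBM]; exact mul_self_apply_self_nonneg hBs i
  have hMM : M * M = NormedSpace.exp Y := by rw [hM, ← pow_two, exp_inv_two_smul_sq]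
  rw [← hM, ← hMM]
  have hb : ∀ w, (NormedSpace.exp (Y + colMatrix s q w)).trace ≤ (M * M).trace +
      ((M * M * colMatrix s q w).trace + (4⁻¹ * (M * M * (colMatrix s q w * colMatrix s q w)).trace
      + (4⁻¹ * (M * colMatrix s q w * (M * colMatrix s q w)).trace
      + 6⁻¹ * ((Real.exp (colRadius s q w) - 1) *
        (M * M * (colMatrix s q w * colMatrix s q w)).trace)))) := fun w =>
    (trace_exp_add_le_second_order hY (colMatrix_isSymm s q w) (colRadius_nonneg s q w)
      (trace_colMatrix_sq_le s q w) hM).trans_eq (by ring)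
  refine (colExp_mono h0 h1 hb).trans ?_
  rw [colExp_add, colExp_add, colExp_add, colExp_add, colExp_const, colExp_trace_mul,
    colExp_const_mul, colExp_const_mul, colExp_const_mul]
  have e1 := colExp_trace_mul_sq_le h0 h1 hv hv0 s (mul_self_apply_self_nonneg hMs)
  have e2 := colExp_trace_mul_mul_le h0 h1 hv hn s hMs hM0
  have e3 := colExp_third_order_le h0 h1 hv hv0 hs hMs
  rw [← hκ] at e3
  linarith

theorem colExp_sq_trace_exp_add_le (h0 : ∀ i, 0 ≤ q i) (h1 : ∀ i, q i ≤ 1)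
    (hv : ∀ i, q i * (1 - q i) ≤ v) (hv0 : 0 ≤ v) (hn : 0 < n) {s κ : ℝ}
    (hs : |s| * (1 + n * v) ≤ 1 / 2)
    (hκ : κ = |s| * (1 + n * v) / (1 - |s| * (1 + n * v)))
    {Y : Matrix (Fin n) (Fin n) ℝ} (hY : Y.IsSymm) :
    colExp q (fun w => (NormedSpace.exp ((2 : ℝ)⁻¹ • (Y + colMatrix s q w))).trace ^ 2) ≤
      (1 + s ^ 2 * v ^ 2 * (n - 1) / 4 - s ^ 2 * v ^ 2 / (2 * n) + s ^ 2 * v ^ 2 * n * κ / 2) *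
        (NormedSpace.exp ((2 : ℝ)⁻¹ • Y)).trace ^ 2 +
        s ^ 2 * v ^ 2 / 2 * (NormedSpace.exp Y).trace := by
  have : Nonempty (Fin n) := ⟨⟨0, hn⟩⟩
  obtain ⟨M, hM⟩ : ∃ M, M = NormedSpace.exp ((2 : ℝ)⁻¹ • Y) := ⟨_, rfl⟩
  have hMs : M.IsSymm := hM ▸ isSymm_exp (hY.smul _)
  obtain ⟨B, hB⟩ : ∃ B, B = NormedSpace.exp ((2 : ℝ)⁻¹ • (2 : ℝ)⁻¹ • Y) := ⟨_, rfl⟩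
  have hBs : B.IsSymm := hB ▸ isSymm_exp ((hY.smul _).smul _)
  have hBM : B * B = M := by rw [hB, ← pow_two, exp_inv_two_smul_sq, hM]
  have hM0 : ∀ i, 0 ≤ M i i := fun i => by rw [← hBM]; exact mul_self_apply_self_nonneg hBs i
  have hMM : M * M = NormedSpace.exp Y := by rw [hM, ← pow_two, exp_inv_two_smul_sq]
  rw [← hM, ← hMM]
  have hb : ∀ w, (NormedSpace.exp ((2 : ℝ)⁻¹ • (Y + colMatrix s q w))).trace ^ 2 ≤ M.trace ^ 2 +
      (M.trace * (M * colMatrix s q w).trace +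
      (M.trace / 4 * (M * (colMatrix s q w * colMatrix s q w)).trace
      + (4⁻¹ * (M * colMatrix s q w).trace ^ 2
      + M.trace / 6 * ((Real.exp (colRadius s q w) - 1) *
        (M * (colMatrix s q w * colMatrix s q w)).trace)))) := fun w =>
    (sq_trace_exp_add_le_second_order hY (colMatrix_isSymm s q w) (colRadius_nonneg s q w)
      (trace_colMatrix_sq_le s q w) hM).trans_eq (by ring)
  refine (colExp_mono h0 h1 hb).trans ?_
  rw [colExp_add, colExp_add, colExp_add, colExp_add, colExp_const, colExp_const_mul,
    colExp_trace_mul, colExp_const_mul, colExp_const_mul, colExp_const_mul]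
  have ht0 : 0 ≤ M.trace := Finset.sum_nonneg fun i _ => hM0 i
  have e1 := mul_le_mul_of_nonneg_left (colExp_trace_mul_sq_le h0 h1 hv hv0 s hM0) ht0
  have e2 := colExp_trace_mul_pow_le h0 h1 hv hn s hMs
  have e3 := colExp_third_order_le h0 h1 hv hv0 hs hBs
  rw [hBM, ← hκ] at e3
  have e3' := mul_le_mul_of_nonneg_left e3 ht0
  have hn' : (n : ℝ) ≠ 0 := by exact_mod_cast hn.ne'
  have e4 : s ^ 2 * v ^ 2 / (2 * n) * M.trace ^ 2 =
      4⁻¹ * (s ^ 2 * v ^ 2 * (2 / n * M.trace ^ 2)) := by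
    field_simp; ring
  linear_combination 4⁻¹ * e1 + 4⁻¹ * e2 + 6⁻¹ * e3' - e4

end ColumnStep

end BSBM

namespace BSBM

open Matrix

/-! ### The two-dimensional comparison system. -/

section Comparison

/-- The growth rate of the dominant mode of the comparison system. -/
noncomputable def rateTop (n : ℝ) : ℝ := (n + 1) / 4 - 1 / (2 * n)

/-- The growth rate of the second mode of the comparison system. -/
noncomputable def rateLow (n : ℝ) : ℝ := (n - 2) / 4

/-- First component of the solution of the comparison system, started at `1`. -/
noncomputable def traceMajorant (n β : ℝ) : ℝ :=
  (n ^ 2 * Real.exp (rateTop n * β) - (n - 1) * (n - 2) * Real.exp (rateLow n * β)) / (3 * n - 2)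

/-- Second component of the solution of the comparison system, started at `1`. -/
noncomputable def sqTraceMajorant (n β : ℝ) : ℝ :=
  (n * Real.exp (rateTop n * β) + 2 * (n - 1) * Real.exp (rateLow n * β)) / (3 * n - 2)

theorem rateLow_nonneg {n : ℝ} (hn : 2 ≤ n) : 0 ≤ rateLow n := by unfold rateLow; linarith

theorem rateLow_le_rateTop {n : ℝ} (hn : 2 ≤ n) : rateLow n ≤ rateTop n := by
  unfold rateLow rateTop
  have : 1 / (2 * n) ≤ 3 / 4 := by rw [div_le_div_iff₀ (by linarith) (by norm_num)]; linarith
  linarith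

theorem traceMajorant_zero {n : ℝ} (hn : 2 ≤ n) : traceMajorant n 0 = 1 := by
  have : 3 * n - 2 ≠ 0 := by linarith
  simp only [traceMajorant, mul_zero, Real.exp_zero]
  rw [div_eq_one_iff_eq this]; ring

theorem sqTraceMajorant_zero {n : ℝ} (hn : 2 ≤ n) : sqTraceMajorant n 0 = 1 := by
  have : 3 * n - 2 ≠ 0 := by linarith
  simp only [sqTraceMajorant, mul_zero, Real.exp_zero]
  rw [div_eq_one_iff_eq this]; ring

theorem exp_sub_self_mono {x y : ℝ} (hx : 0 ≤ x) (hxy : x ≤ y) :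
    Real.exp x - 1 - x ≤ Real.exp y - 1 - y := by
  have h1 : Real.exp y = Real.exp x * Real.exp (y - x) := by rw [← Real.exp_add]; ring_nf
  have h2 := Real.add_one_le_exp (y - x)
  have h3 := Real.one_le_exp hx
  nlinarith

theorem sqTraceMajorant_nonneg {n β : ℝ} (hn : 2 ≤ n) : 0 ≤ sqTraceMajorant n β := by
  unfold sqTraceMajorant
  have h1 : 0 < 3 * n - 2 := by linarith
  have h2 : 0 ≤ n - 1 := by linarith
  have h3 : 0 ≤ n := by linarith
  positivity

theorem traceMajorant_nonneg {n β : ℝ} (hn : 2 ≤ n) (hβ : 0 ≤ β) : 0 ≤ traceMajorant n β := by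
  unfold traceMajorant
  have h1 : 0 < 3 * n - 2 := by linarith
  refine div_nonneg ?_ h1.le
  have h2 : Real.exp (rateLow n * β) ≤ Real.exp (rateTop n * β) :=
    Real.exp_le_exp.2 (mul_le_mul_of_nonneg_right (rateLow_le_rateTop hn) hβ)
  have h3 : (n - 1) * (n - 2) ≤ n ^ 2 := by nlinarith
  have h4 : 0 ≤ (n - 1) * (n - 2) := mul_nonneg (by linarith) (by linarith)
  exact sub_nonneg.2 (mul_le_mul h3 h2 (Real.exp_pos _).le (by positivity))

/-- The slow mode enters with a negative sign, where 1 + x ≤ e^x points the wrong way. Its excess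
e^x − 1 − x is outweighed by that of the dominant mode, which has the larger rate and coefficient.
-/
theorem traceMajorant_step {n β b : ℝ} (hn : 2 ≤ n) (hβ : 0 ≤ β) (hb : 0 ≤ b) :
    (1 + b * n / 4) * traceMajorant n β + b * (n - 2) / 4 * sqTraceMajorant n β ≤
      traceMajorant n (β + b) := by
  have h1 : 0 < 3 * n - 2 := by linarith
  have hn0 : n ≠ 0 := by linarith
  have e1 : Real.exp (rateTop n * (β + b)) = Real.exp (rateTop n * β) * Real.exp (rateTop n * b) := by
    rw [← Real.exp_add]; ring_nf
  have e2 : Real.exp (rateLow n * (β + b)) = Real.exp (rateLow n * β) * Real.exp (rateLow n * b) := by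
    rw [← Real.exp_add]; ring_nf
  have hx : 0 ≤ rateLow n * b := mul_nonneg (rateLow_nonneg hn) hb
  have hxy : rateLow n * b ≤ rateTop n * b :=
    mul_le_mul_of_nonneg_right (rateLow_le_rateTop hn) hb
  have h2 : Real.exp (rateLow n * β) ≤ Real.exp (rateTop n * β) :=
    Real.exp_le_exp.2 (mul_le_mul_of_nonneg_right (rateLow_le_rateTop hn) hβ)
  have h3 : (n - 1) * (n - 2) ≤ n ^ 2 := by nlinarith
  have h4 : 0 ≤ (n - 1) * (n - 2) := mul_nonneg (by linarith) (by linarith)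
  have h5 := exp_sub_self_mono hx hxy
  have h6 : 0 ≤ Real.exp (rateLow n * b) - 1 - rateLow n * b := by
    linarith [Real.add_one_le_exp (rateLow n * b)]
  have h7 := mul_le_mul (mul_le_mul h3 h2 (Real.exp_pos _).le (by positivity)) h5 h6 (by positivity)
  have e3 : (1 + b * n / 4) * traceMajorant n β + b * (n - 2) / 4 * sqTraceMajorant n β =
      (n ^ 2 * Real.exp (rateTop n * β) * (1 + rateTop n * b) -
        (n - 1) * (n - 2) * Real.exp (rateLow n * β) * (1 + rateLow n * b)) / (3 * n - 2) := by
    simp only [traceMajorant, sqTraceMajorant]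
    generalize Real.exp (rateTop n * β) = x
    generalize Real.exp (rateLow n * β) = y
    rw [← mul_div_assoc, ← mul_div_assoc, ← add_div, rateTop, rateLow]
    congr 1
    field_simp
    ring
  rw [e3, traceMajorant, e1, e2]
  refine div_le_div_of_nonneg_right ?_ h1.le
  linarith

theorem sqTraceMajorant_step {n β b : ℝ} (hn : 2 ≤ n) :
    (1 + b * (n - 1) / 4 - b / (2 * n)) * sqTraceMajorant n β + b / (2 * n) * traceMajorant n β ≤
      sqTraceMajorant n (β + b) := by
  have h1 : 0 < 3 * n - 2 := by linarith
  have hn0 : n ≠ 0 := by linarith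
  have e1 : Real.exp (rateTop n * (β + b)) = Real.exp (rateTop n * β) * Real.exp (rateTop n * b) := by
    rw [← Real.exp_add]; ring_nf
  have e2 : Real.exp (rateLow n * (β + b)) = Real.exp (rateLow n * β) * Real.exp (rateLow n * b) := by
    rw [← Real.exp_add]; ring_nf
  have e3 : (1 + b * (n - 1) / 4 - b / (2 * n)) * sqTraceMajorant n β +
      b / (2 * n) * traceMajorant n β =
      (n * Real.exp (rateTop n * β) * (1 + rateTop n * b) +
        2 * (n - 1) * Real.exp (rateLow n * β) * (1 + rateLow n * b)) / (3 * n - 2) := by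
    simp only [traceMajorant, sqTraceMajorant]
    generalize Real.exp (rateTop n * β) = x
    generalize Real.exp (rateLow n * β) = y
    rw [← mul_div_assoc, ← mul_div_assoc, ← add_div, rateTop, rateLow]
    congr 1
    field_simp
    ring
  rw [e3, sqTraceMajorant, e1, e2]
  refine div_le_div_of_nonneg_right ?_ h1.le
  have h2 := Real.add_one_le_exp (rateTop n * b)
  have h3 := Real.add_one_le_exp (rateLow n * b)
  have h4 : 0 ≤ n * Real.exp (rateTop n * β) := by positivity
  have h5 : 0 ≤ 2 * (n - 1) * Real.exp (rateLow n * β) :=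
    mul_nonneg (by linarith) (Real.exp_pos _).le
  nlinarith

end Comparison

/-! ### Iteration over all columns. -/

section MultiColumn

variable {n : ℕ}

/-- The expectation over independent Bernoulli columns with parameters `Q j i`. -/
def multiExp {N : ℕ} (Q : Fin N → Fin n → ℝ) (f : (Fin N → Fin n → Bool) → ℝ) : ℝ :=
  ∑ c, (∏ j, ∏ i, bernWeight (Q j i) (c j i)) * f c

theorem multiExp_add {N : ℕ} (Q : Fin N → Fin n → ℝ) (f g : (Fin N → Fin n → Bool) → ℝ) :
    multiExp Q (fun c => f c + g c) = multiExp Q f + multiExp Q g := by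
  simp [multiExp, mul_add, Finset.sum_add_distrib]

theorem multiExp_const_mul {N : ℕ} (Q : Fin N → Fin n → ℝ) (a : ℝ)
    (f : (Fin N → Fin n → Bool) → ℝ) : multiExp Q (fun c => a * f c) = a * multiExp Q f := by
  simp only [multiExp, Finset.mul_sum]
  exact Finset.sum_congr rfl fun w _ => by ring

theorem multiExp_mono {N : ℕ} {Q : Fin N → Fin n → ℝ} (h0 : ∀ j i, 0 ≤ Q j i)
    (h1 : ∀ j i, Q j i ≤ 1) {f g : (Fin N → Fin n → Bool) → ℝ} (h : ∀ c, f c ≤ g c) :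
    multiExp Q f ≤ multiExp Q g :=
  Finset.sum_le_sum fun c _ => mul_le_mul_of_nonneg_left (h c)
    (Finset.prod_nonneg fun j _ => Finset.prod_nonneg fun i _ =>
      bernWeight_nonneg (h0 j i) (h1 j i) _)

theorem multiExp_succ {N : ℕ} (Q : Fin (N + 1) → Fin n → ℝ)
    (f : (Fin (N + 1) → Fin n → Bool) → ℝ) :
    multiExp Q f = multiExp (fun j => Q j.succ) fun c =>
      colExp (Q 0) fun w => f (Fin.cons w c) := by
  rw [multiExp, ← (Fin.consEquiv fun _ => Fin n → Bool).sum_comp, Fintype.sum_prod_type,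
    Finset.sum_comm]
  simp only [multiExp, colExp, Finset.mul_sum]
  refine Finset.sum_congr rfl fun c _ => Finset.sum_congr rfl fun w _ => ?_
  simp only [Fin.consEquiv, Equiv.coe_fn_mk, Fin.prod_univ_succ, Fin.cons_zero, Fin.cons_succ]
  ring

theorem multiExp_const {N : ℕ} (Q : Fin N → Fin n → ℝ) (a : ℝ) : multiExp Q (fun _ => a) = a := by
  induction N with
  | zero => simp [multiExp]
  | succ N ih => rw [multiExp_succ]; simp only [colExp_const, ih]

/-- The sum of the hollow Gram matrices of the centred columns. -/
noncomputable def gramSum {N : ℕ} (s : ℝ) (Q : Fin N → Fin n → ℝ) (c : Fin N → Fin n → Bool) :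
    Matrix (Fin n) (Fin n) ℝ := ∑ j, colMatrix s (Q j) (c j)

theorem gramSum_isSymm {N : ℕ} (s : ℝ) (Q : Fin N → Fin n → ℝ) (c : Fin N → Fin n → Bool) :
    (gramSum s Q c).IsSymm := by
  rw [IsSymm, gramSum, transpose_sum]
  exact Finset.sum_congr rfl fun j _ => colMatrix_isSymm _ _ _

theorem gramSum_cons {N : ℕ} (s : ℝ) (Q : Fin (N + 1) → Fin n → ℝ) (w : Fin n → Bool)
    (c : Fin N → Fin n → Bool) :
    gramSum s Q (Fin.cons w c) = gramSum s (fun j => Q j.succ) c + colMatrix s (Q 0) w := by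
  rw [gramSum, Fin.sum_univ_succ, add_comm]; rfl

/-- The recursions for the two traces are coupled, so both bounds are carried through one induction
on the columns. The prefactors n and n² are the values at the zero matrix. -/
theorem multiExp_trace_exp_le {v : ℝ} (hv0 : 0 ≤ v) (hn : 2 ≤ n) {s κ : ℝ}
    (hs : |s| * (1 + n * v) ≤ 1 / 2)
    (hκ : κ = |s| * (1 + n * v) / (1 - |s| * (1 + n * v))) {N : ℕ} (Q : Fin N → Fin n → ℝ)
    (h0 : ∀ j i, 0 ≤ Q j i) (h1 : ∀ j i, Q j i ≤ 1) (hv : ∀ j i, Q j i * (1 - Q j i) ≤ v) :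
    multiExp Q (fun c => (NormedSpace.exp (gramSum s Q c)).trace) ≤
        n * (Real.exp (N * (s ^ 2 * v ^ 2 * n * κ / 2)) * traceMajorant n (N * (s ^ 2 * v ^ 2))) ∧
      multiExp Q (fun c => (NormedSpace.exp ((2 : ℝ)⁻¹ • gramSum s Q c)).trace ^ 2) ≤
        n ^ 2 * (Real.exp (N * (s ^ 2 * v ^ 2 * n * κ / 2)) *
          sqTraceMajorant n (N * (s ^ 2 * v ^ 2))) := by
  have hnR : (2 : ℝ) ≤ n := by exact_mod_cast hn
  have hn0 : (n : ℝ) ≠ 0 := by positivity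
  set b := s ^ 2 * v ^ 2 with hb
  have hb0 : 0 ≤ b := by positivity
  have hκ0 : 0 ≤ κ := by
    rw [hκ]; exact div_nonneg (by positivity) (by linarith)
  set d := b * n * κ / 2 with hd
  have hd0 : 0 ≤ d := by positivity
  induction N with
  | zero =>
    have hg : ∀ c, gramSum s Q c = 0 := fun c => by simp [gramSum]
    simp [hg, traceMajorant_zero hnR, sqTraceMajorant_zero hnR, multiExp_const]
  | succ N ih =>
    obtain ⟨ihT, ihR⟩ := ih (fun j => Q j.succ) (fun j => h0 j.succ) (fun j => h1 j.succ)
      fun j => hv j.succ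
    set x := Real.exp (N * d) with hx
    have hx0 : 0 < x := Real.exp_pos _
    set T := multiExp (fun j => Q j.succ)
      (fun c => (NormedSpace.exp (gramSum s (fun j => Q j.succ) c)).trace) with hT
    set R := multiExp (fun j => Q j.succ)
      (fun c => (NormedSpace.exp ((2 : ℝ)⁻¹ • gramSum s (fun j => Q j.succ) c)).trace ^ 2) with hR
    set m := traceMajorant n (N * b) with hm
    set r := sqTraceMajorant n (N * b) with hr
    have hβ : (0 : ℝ) ≤ N * b := by positivity
    have hm0 : 0 ≤ m := traceMajorant_nonneg hnR hβ
    have hr0 : 0 ≤ r := sqTraceMajorant_nonneg hnR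
    have hcast : ((N + 1 : ℕ) : ℝ) * b = N * b + b := by push_cast; ring
    have hexp : Real.exp (((N + 1 : ℕ) : ℝ) * d) = x * Real.exp d := by
      rw [hx, ← Real.exp_add]; push_cast; ring_nf
    have hd1 := Real.add_one_le_exp d
    have hn2 : 0 ≤ 1 - 2 / (n : ℝ) := by
      rw [sub_nonneg, div_le_one (by linarith)]; exact hnR
    rw [hcast, hexp]
    constructor
    · rw [multiExp_succ]
      simp only [gramSum_cons]
      calc _ ≤ multiExp (fun j => Q j.succ) (fun c => (1 + b * n / 4 + d) *
              (NormedSpace.exp (gramSum s (fun j => Q j.succ) c)).trace +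
              b / 4 * (1 - 2 / n) *
                (NormedSpace.exp ((2 : ℝ)⁻¹ • gramSum s (fun j => Q j.succ) c)).trace ^ 2) :=
            multiExp_mono (fun j => h0 j.succ) (fun j => h1 j.succ) fun c =>
              colExp_trace_exp_add_le (h0 0) (h1 0) (hv 0) hv0 (by omega) hs hκ
                (gramSum_isSymm _ _ _)
        _ = (1 + b * n / 4 + d) * T + b / 4 * (1 - 2 / n) * R := by
            rw [multiExp_add, multiExp_const_mul, multiExp_const_mul]
        _ ≤ (1 + b * n / 4 + d) * (n * (x * m)) + b / 4 * (1 - 2 / n) * (n ^ 2 * (x * r)) := by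
            gcongr
        _ = n * x * (((1 + b * n / 4) * m + b * (n - 2) / 4 * r) + d * m) := by
            field_simp
            ring
        -- The main bracket is at least m, so adding d m is at most multiplying it by 1 + d ≤ e^d.
        _ ≤ n * x * (((1 + b * n / 4) * m + b * (n - 2) / 4 * r) * Real.exp d) := by
            have h2 : 0 ≤ b * (n - 2) / 4 * r :=
              mul_nonneg (div_nonneg (mul_nonneg hb0 (by linarith)) (by norm_num)) hr0
            have h3 : 0 ≤ b * n / 4 * m := by positivity
            refine mul_le_mul_of_nonneg_left ?_ (by positivity)
            nlinarith
        _ ≤ n * x * (traceMajorant n (N * b + b) * Real.exp d) := by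
            have := traceMajorant_step hnR hβ hb0
            gcongr
        _ = _ := by ring
    · rw [multiExp_succ]
      simp only [gramSum_cons]
      -- Equality holds at n = 2.
      have hcoef : 0 ≤ b * (n - 1) / 4 - b / (2 * n) := by
        rw [sub_nonneg, div_le_div_iff₀ (by positivity) (by norm_num)]
        nlinarith [mul_nonneg hb0 (sub_nonneg.2 hnR),
          mul_nonneg (mul_nonneg hb0 (sub_nonneg.2 hnR)) (sub_nonneg.2 hnR)]
      calc _ ≤ multiExp (fun j => Q j.succ) (fun c => (1 + b * (n - 1) / 4 - b / (2 * n) + d) *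
              (NormedSpace.exp ((2 : ℝ)⁻¹ • gramSum s (fun j => Q j.succ) c)).trace ^ 2 +
              b / 2 * (NormedSpace.exp (gramSum s (fun j => Q j.succ) c)).trace) :=
            multiExp_mono (fun j => h0 j.succ) (fun j => h1 j.succ) fun c =>
              colExp_sq_trace_exp_add_le (h0 0) (h1 0) (hv 0) hv0 (by omega) hs hκ
                (gramSum_isSymm _ _ _)
        _ = (1 + b * (n - 1) / 4 - b / (2 * n) + d) * R + b / 2 * T := by
            rw [multiExp_add, multiExp_const_mul, multiExp_const_mul]
        _ ≤ (1 + b * (n - 1) / 4 - b / (2 * n) + d) * (n ^ 2 * (x * r)) +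
            b / 2 * (n * (x * m)) := by
            have h2 : 0 ≤ 1 + b * (n - 1) / 4 - b / (2 * n) + d := by linarith
            gcongr
        _ = n ^ 2 * x * (((1 + b * (n - 1) / 4 - b / (2 * n)) * r + b / (2 * n) * m) + d * r) := by
            field_simp
            ring
        _ ≤ n ^ 2 * x * (((1 + b * (n - 1) / 4 - b / (2 * n)) * r + b / (2 * n) * m) *
            Real.exp d) := by
            have h2 : 0 ≤ b / (2 * n) * m := by positivity
            have h3 := mul_nonneg hcoef hr0
            refine mul_le_mul_of_nonneg_left ?_ (by positivity)
            nlinarith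
        _ ≤ n ^ 2 * x * (sqTraceMajorant n (N * b + b) * Real.exp d) := by
            have := sqTraceMajorant_step (β := N * b) (b := b) hnR
            gcongr
        _ = _ := by ring

end MultiColumn

end BSBM

namespace BSBM

open Matrix

/-! ### From the spectral norm to the trace of cosh. -/

section SpectralNorm

variable {n : ℕ}

theorem exists_le_abs_of_le_spectralNorm {U : Matrix (Fin n) (Fin n) ℝ} {z : Fin n → ℝ}
    (h1 : U * Uᵀ = 1) (h2 : Uᵀ * U = 1) {t : ℝ} (ht : 0 < t)
    (h : t ≤ spectralNorm (U * diagonal z * Uᵀ)) : ∃ a, t ≤ |z a| := by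
  by_contra! hz
  have hU : ∀ V : Matrix (Fin n) (Fin n) ℝ, Vᵀ * V = 1 → V * Vᵀ = 1 →
      ‖Matrix.toEuclideanCLM (n := Fin n) (𝕜 := ℝ) V‖ ≤ 1 := by
    intro V hV1 hV2
    have hmem : Matrix.toEuclideanCLM (n := Fin n) (𝕜 := ℝ) V ∈
        unitary (EuclideanSpace ℝ (Fin n) →L[ℝ] EuclideanSpace ℝ (Fin n)) := by
      rw [Unitary.mem_iff, ← map_star, ← map_mul, ← map_mul, star_eq_conjTranspose,
        conjTranspose_eq_transpose_of_trivial, hV1, hV2, map_one]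
      exact ⟨rfl, rfl⟩
    have hsq := CStarRing.norm_star_mul_self (x := Matrix.toEuclideanCLM (n := Fin n) (𝕜 := ℝ) V)
    rw [(Unitary.mem_iff.1 hmem).1] at hsq
    have : ‖(1 : EuclideanSpace ℝ (Fin n) →L[ℝ] EuclideanSpace ℝ (Fin n))‖ ≤ 1 :=
      ContinuousLinearMap.norm_id_le
    nlinarith [norm_nonneg (Matrix.toEuclideanCLM (n := Fin n) (𝕜 := ℝ) V)]
  have hD : ‖Matrix.toEuclideanCLM (n := Fin n) (𝕜 := ℝ) (diagonal z)‖ = ‖z‖ :=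
    l2_opNorm_diagonal z
  have hle : spectralNorm (U * diagonal z * Uᵀ) ≤ ‖z‖ := by
    rw [spectralNorm, map_mul, map_mul]
    calc _ ≤ ‖Matrix.toEuclideanCLM (n := Fin n) (𝕜 := ℝ) U‖ *
          ‖Matrix.toEuclideanCLM (n := Fin n) (𝕜 := ℝ) (diagonal z)‖ *
          ‖Matrix.toEuclideanCLM (n := Fin n) (𝕜 := ℝ) Uᵀ‖ :=
          (norm_mul_le _ _).trans (mul_le_mul_of_nonneg_right (norm_mul_le _ _) (norm_nonneg _))
      _ ≤ 1 * ‖z‖ * 1 := by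
          rw [hD]
          have := hU U h2 h1
          have := hU Uᵀ (by rw [transpose_transpose, h1]) (by rw [transpose_transpose, h2])
          gcongr
      _ = _ := by ring
  have hlt : ‖z‖ < t := (pi_norm_lt_iff ht).2 hz
  linarith

theorem trace_exp_smul_eq {U : Matrix (Fin n) (Fin n) ℝ} {z : Fin n → ℝ}
    (h1 : U * Uᵀ = 1) (h2 : Uᵀ * U = 1) (θ : ℝ) :
    (NormedSpace.exp (θ • (U * diagonal z * Uᵀ))).trace = ∑ a, Real.exp (θ * z a) := by
  rw [← smul_mul_assoc, ← mul_smul_comm, ← diagonal_smul, exp_conj_diagonal h1, mul_assoc,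
    trace_mul_comm, mul_assoc, h2, mul_one, trace_diagonal]
  rfl

/-- The hyperbolic cosine detects large spectral norms in the trace. -/
theorem cosh_sub_one_le_trace {X : Matrix (Fin n) (Fin n) ℝ} (hX : X.IsSymm) {θ t : ℝ}
    (ht : 0 < t) (h : t ≤ spectralNorm X) :
    Real.cosh (θ * t) - 1 ≤
      ((NormedSpace.exp (θ • X)).trace + (NormedSpace.exp ((-θ) • X)).trace) / 2 - n := by
  obtain ⟨U, z, h1, h2, rfl⟩ := exists_orthogonal_diagonalization hX
  obtain ⟨a, ha⟩ := exists_le_abs_of_le_spectralNorm h1 h2 ht h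
  rw [trace_exp_smul_eq h1 h2, trace_exp_smul_eq h1 h2, ← Finset.sum_add_distrib,
    Finset.sum_div]
  have e : ∀ a, (Real.exp (θ * z a) + Real.exp (-θ * z a)) / 2 = Real.cosh (θ * z a) := by
    intro a; rw [Real.cosh_eq, neg_mul]
  simp only [e]
  have e2 : ∑ a, Real.cosh (θ * z a) - n = ∑ a, (Real.cosh (θ * z a) - 1) := by
    simp [Finset.sum_sub_distrib]
  rw [e2]
  have h3 : Real.cosh (θ * t) ≤ Real.cosh (θ * z a) := by
    rw [Real.cosh_le_cosh, abs_mul, abs_mul, abs_of_pos ht]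
    gcongr
  refine (sub_le_sub_right h3 1).trans ?_
  exact Finset.single_le_sum (f := fun a => Real.cosh (θ * z a) - 1)
    (fun a _ => sub_nonneg.2 (Real.one_le_cosh _)) (Finset.mem_univ a)

theorem cosh_trace_sub_card_nonneg (X : Matrix (Fin n) (Fin n) ℝ) (hX : X.IsSymm) (θ : ℝ) :
    0 ≤ ((NormedSpace.exp (θ • X)).trace + (NormedSpace.exp ((-θ) • X)).trace) / 2 - n := by
  obtain ⟨U, z, h1, h2, rfl⟩ := exists_orthogonal_diagonalization hX
  rw [trace_exp_smul_eq h1 h2, trace_exp_smul_eq h1 h2, ← Finset.sum_add_distrib,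
    Finset.sum_div]
  have e : ∀ a, (Real.exp (θ * z a) + Real.exp (-θ * z a)) / 2 = Real.cosh (θ * z a) := by
    intro a; rw [Real.cosh_eq, neg_mul]
  simp only [e]
  have e2 : ∑ a, Real.cosh (θ * z a) - n = ∑ a, (Real.cosh (θ * z a) - 1) := by
    simp [Finset.sum_sub_distrib]
  rw [e2]
  exact Finset.sum_nonneg fun a _ => sub_nonneg.2 (Real.one_le_cosh _)

open Classical in
/-- Markov's inequality for the trace of the hyperbolic cosine. -/
theorem multiExp_indicator_mul_le {v : ℝ} (hv0 : 0 ≤ v) (hn : 2 ≤ n) {θ κ : ℝ} (hθ0 : 0 ≤ θ)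
    (hθ : θ * (1 + n * v) ≤ 1 / 2)
    (hκ : κ = θ * (1 + n * v) / (1 - θ * (1 + n * v))) {N : ℕ} (Q : Fin N → Fin n → ℝ)
    (h0 : ∀ j i, 0 ≤ Q j i) (h1 : ∀ j i, Q j i ≤ 1) (hv : ∀ j i, Q j i * (1 - Q j i) ≤ v)
    {t : ℝ} (ht : 0 < t) :
    multiExp Q (fun c => if t ≤ spectralNorm (gramSum 1 Q c) then 1 else 0) *
        (Real.cosh (θ * t) - 1) ≤
      n * (Real.exp (N * (θ ^ 2 * v ^ 2 * n * κ / 2)) * traceMajorant n (N * (θ ^ 2 * v ^ 2)) - 1)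
      := by
  have hsm : ∀ (s : ℝ) c, gramSum s Q c = s • gramSum 1 Q c := by
    intro s c
    simp only [gramSum, colMatrix, one_smul, Finset.smul_sum]
  -- The majorant depends on s only through |s| and s², so θ and −θ share one bound and their
  -- average costs no factor 2.
  have hpos := (multiExp_trace_exp_le hv0 hn (s := θ) (κ := κ) (by rwa [abs_of_nonneg hθ0])
    (by rwa [abs_of_nonneg hθ0]) Q h0 h1 hv).1
  have hneg := (multiExp_trace_exp_le hv0 hn (s := -θ) (κ := κ)
    (by rwa [abs_neg, abs_of_nonneg hθ0]) (by rwa [abs_neg, abs_of_nonneg hθ0]) Q h0 h1 hv).1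
  rw [neg_sq] at hneg
  rw [mul_comm, ← multiExp_const_mul]
  have hb : ∀ c, (Real.cosh (θ * t) - 1) *
      (if t ≤ spectralNorm (gramSum 1 Q c) then 1 else 0) ≤
      2⁻¹ * (NormedSpace.exp (gramSum θ Q c)).trace +
        (2⁻¹ * (NormedSpace.exp (gramSum (-θ) Q c)).trace + -(n : ℝ)) := by
    intro c
    rw [hsm θ, hsm (-θ)]
    split_ifs with h
    · have := cosh_sub_one_le_trace (gramSum_isSymm 1 Q c) (θ := θ) ht h
      linarith
    · have := cosh_trace_sub_card_nonneg _ (gramSum_isSymm 1 Q c) θ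
      linarith
  refine (multiExp_mono h0 h1 hb).trans ?_
  rw [multiExp_add, multiExp_add, multiExp_const_mul, multiExp_const_mul, multiExp_const]
  linarith

end SpectralNorm

end BSBM

namespace BSBM

/-! ### Numerical bounds for the majorant. -/

section MajorantEstimates

/-- Taking q-th powers replaces a fractional power of n by a rational inequality that can be checked
numerically. -/
theorem exp_neg_mul_log_le {n c : ℝ} (hn : 0 < n) (hc : 0 ≤ c) {p q : ℕ} (hq : q ≠ 0)
    (h : 1 ≤ c ^ q * n ^ p) : Real.exp (-(p / q : ℝ) * Real.log n) ≤ c := by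
  have hq' : (q : ℝ) ≠ 0 := by exact_mod_cast hq
  refine le_of_pow_le_pow_left₀ hq hc ?_
  have e : Real.exp (-(p / q : ℝ) * Real.log n) ^ q = (n ^ p)⁻¹ := by
    rw [← Real.exp_nat_mul, show (q : ℝ) * (-(p / q : ℝ) * Real.log n) = -(p * Real.log n) by
      field_simp, Real.exp_neg, Real.exp_nat_mul, Real.exp_log hn]
  rw [e]
  exact (inv_le_iff_one_le_mul₀ (by positivity)).2 h

theorem log_le_of_pow_le {n : ℝ} (hn : 0 < n) {p q : ℕ} (hq : q ≠ 0)
    (h : n ^ q ≤ (2.718 : ℝ) ^ p) : Real.log n ≤ p / q := by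
  have hq' : (0 : ℝ) < q := by positivity
  rw [le_div_iff₀ hq', mul_comm, ← Real.log_pow, Real.log_le_iff_le_exp (by positivity)]
  refine h.trans ?_
  rw [← mul_one (p : ℝ), Real.exp_nat_mul]
  have := Real.exp_one_gt_d9
  gcongr
  linarith

theorem le_log_of_pow_le {n : ℝ} (hn : 0 < n) {p q : ℕ} (hq : q ≠ 0)
    (h : (2.7183 : ℝ) ^ p ≤ n ^ q) : (p / q : ℝ) ≤ Real.log n := by
  have hq' : (0 : ℝ) < q := by positivity
  rw [div_le_iff₀ hq', mul_comm, ← Real.log_pow, Real.le_log_iff_exp_le (by positivity)]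
  refine le_trans ?_ h
  rw [← mul_one (p : ℝ), Real.exp_nat_mul]
  have := Real.exp_one_lt_d9
  gcongr
  linarith

/-- This is the trapezoidal rule for the convex exponential on [0, w]. -/
theorem exp_sub_one_le_trapezoid {w : ℝ} (hw : 0 ≤ w) :
    Real.exp w - 1 ≤ w / 2 * (1 + Real.exp w) := by
  let f : ℝ → ℝ := fun x => x / 2 * (1 + Real.exp x) - Real.exp x
  have hf : ∀ x, HasDerivAt f (1 / 2 * (1 + Real.exp x) + x / 2 * Real.exp x - Real.exp x) x := by
    intro x
    exact (((hasDerivAt_id x).div_const 2).mul ((Real.hasDerivAt_exp x).const_add 1)).sub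
      (Real.hasDerivAt_exp x)
  have hmono : Monotone f := by
    refine monotone_of_deriv_nonneg (fun x => (hf x).differentiableAt) fun x => ?_
    rw [(hf x).deriv]
    have h1 := Real.add_one_le_exp (-x)
    have h2 : Real.exp x * Real.exp (-x) = 1 := by rw [← Real.exp_add]; simp
    nlinarith [Real.exp_pos x]
  have := hmono hw
  simp only [f, zero_div, zero_mul, Real.exp_zero] at this
  linarith

/-- For large n the majorant is a difference quotient: a coefficient of order n against a rate gap
`w` of order 1/n. The trapezoid bound cancels the two and leaves coefficients independent of n. -/
theorem traceMajorant_le_trapezoid {n E : ℝ} (hn : 2 ≤ n) (hE : 0 ≤ E) :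
    traceMajorant n (9 / 2 * E / n) ≤
      (1 + 9 / 16 * E) * Real.exp (9 / 8 * (1 - 2 / n) * E) +
        9 / 16 * E * Real.exp (9 / 8 * (1 + (1 / n - 2 / n ^ 2)) * E) := by
  have hn0 : n ≠ 0 := by linarith
  have h3 : 0 < 3 * n - 2 := by linarith
  set w := 9 / 8 * E * (3 * n - 2) / n ^ 2 with hw
  have hw0 : 0 ≤ w := by positivity
  have e1 : rateLow n * (9 / 2 * E / n) = 9 / 8 * (1 - 2 / n) * E := by
    unfold rateLow; field_simp; ring
  have e2 : rateTop n * (9 / 2 * E / n) = 9 / 8 * (1 - 2 / n) * E + w := by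
    rw [hw]; unfold rateTop; field_simp; ring
  have e3 : 9 / 8 * (1 + (1 / n - 2 / n ^ 2)) * E = 9 / 8 * (1 - 2 / n) * E + w := by
    rw [hw]; field_simp; ring
  have h := exp_sub_one_le_trapezoid hw0
  rw [e3, traceMajorant, e1, e2, Real.exp_add]
  set x := Real.exp (9 / 8 * (1 - 2 / n) * E)
  have hx : 0 < x := Real.exp_pos _
  set y := Real.exp w
  have e4 : (n ^ 2 * (x * y) - (n - 1) * (n - 2) * x) / (3 * n - 2) =
      x + x * (n ^ 2 / (3 * n - 2) * (y - 1)) := by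
    rw [div_eq_iff h3.ne', add_mul, mul_assoc x, div_mul_eq_mul_div, div_mul_cancel₀ _ h3.ne']
    ring
  have e5 : n ^ 2 / (3 * n - 2) * (w / 2 * (1 + y)) = 9 / 16 * E * (1 + y) := by
    have hw2 : w * n ^ 2 = 9 / 8 * E * (3 * n - 2) := by rw [hw]; field_simp
    rw [div_mul_eq_mul_div, div_eq_iff h3.ne']
    linear_combination (1 + y) / 2 * hw2
  rw [e4]
  have h5 : n ^ 2 / (3 * n - 2) * (y - 1) ≤ n ^ 2 / (3 * n - 2) * (w / 2 * (1 + y)) :=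
    mul_le_mul_of_nonneg_left h (by positivity)
  rw [e5] at h5
  nlinarith

/-- After division by exp(2E), both exp(−kE) and E exp(−kE) decrease for E ≥ 1/k. As k ≥ 2/3 and E₀
≥ 3/2, checking at E₀ is enough; `u`, `a₁`, `a₂` are numerical upper bounds there. -/
theorem traceMajorant_le_of_trapezoid {n E E₀ k₁ k₂ u a₁ a₂ : ℝ} (hn : 2 ≤ n) (hE₀ : 3 / 2 ≤ E₀)
    (hE : E₀ ≤ E) (hu : E₀ ≤ u) (h1 : 9 / 8 * (1 - 2 / n) ≤ 2 - k₁)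
    (h2 : 9 / 8 * (1 + (1 / n - 2 / n ^ 2)) ≤ 2 - k₂) (hk₁ : 2 / 3 ≤ k₁) (hk₂ : 2 / 3 ≤ k₂)
    (ha₁ : Real.exp (-k₁ * E₀) ≤ a₁) (ha₂ : Real.exp (-k₂ * E₀) ≤ a₂)
    (h : (1 + 9 / 16 * u) * a₁ + 9 / 16 * u * a₂ ≤ 1 / 2) :
    traceMajorant n (9 / 2 * E / n) ≤ Real.exp (2 * E) / 2 := by
  have hE0 : 0 ≤ E := by linarith
  refine (traceMajorant_le_trapezoid hn hE0).trans ?_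
  have b1 : Real.exp (9 / 8 * (1 - 2 / n) * E) ≤ Real.exp (2 * E) * Real.exp (-k₁ * E) := by
    rw [← Real.exp_add]
    exact Real.exp_le_exp.2 (by nlinarith)
  have b2 : Real.exp (9 / 8 * (1 + (1 / n - 2 / n ^ 2)) * E) ≤
      Real.exp (2 * E) * Real.exp (-k₂ * E) := by
    rw [← Real.exp_add]
    exact Real.exp_le_exp.2 (by nlinarith)
  have dec : ∀ k, 2 / 3 ≤ k → E * Real.exp (-k * E) ≤ E₀ * Real.exp (-k * E₀) ∧
      Real.exp (-k * E) ≤ Real.exp (-k * E₀) := by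
    intro k hk
    have e : Real.exp (-k * E) = Real.exp (-k * E₀) * Real.exp (-(k * (E - E₀))) := by
      rw [← Real.exp_add]; ring_nf
    have f1 : E ≤ E₀ * Real.exp (k * (E - E₀)) := by
      have := Real.add_one_le_exp (k * (E - E₀))
      nlinarith [mul_nonneg (sub_nonneg.2 hE) (sub_nonneg.2 hk)]
    constructor
    · have f2 : E * Real.exp (-(k * (E - E₀))) ≤ E₀ := by
        rw [Real.exp_neg, ← div_eq_mul_inv, div_le_iff₀ (Real.exp_pos _)]; exact f1
      rw [e]
      nlinarith [Real.exp_pos (-k * E₀)]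
    · exact Real.exp_le_exp.2 (by nlinarith)
  obtain ⟨d1, d1'⟩ := dec k₁ hk₁
  obtain ⟨d2, -⟩ := dec k₂ hk₂
  have p1 := Real.exp_pos (-k₁ * E₀)
  have p2 := Real.exp_pos (-k₂ * E₀)
  have key : (1 + 9 / 16 * E) * Real.exp (-k₁ * E) + 9 / 16 * E * Real.exp (-k₂ * E) ≤ 1 / 2 := by
    have q1 : E₀ * Real.exp (-k₁ * E₀) ≤ u * a₁ := by gcongr; linarith
    have q2 : E₀ * Real.exp (-k₂ * E₀) ≤ u * a₂ := by gcongr; linarith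
    linarith
  have hX := Real.exp_pos (2 * E)
  calc _ ≤ (1 + 9 / 16 * E) * (Real.exp (2 * E) * Real.exp (-k₁ * E)) +
        9 / 16 * E * (Real.exp (2 * E) * Real.exp (-k₂ * E)) := by gcongr
    _ = Real.exp (2 * E) * ((1 + 9 / 16 * E) * Real.exp (-k₁ * E) +
        9 / 16 * E * Real.exp (-k₂ * E)) := by ring
    _ ≤ Real.exp (2 * E) * (1 / 2) := by gcongr
    _ = _ := by ring

theorem traceMajorant_le_of_six_le {n : ℕ} (hn : 6 ≤ n) {E : ℝ} (hE : Real.log n ≤ E) :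
    traceMajorant n (9 / 2 * E / n) ≤ Real.exp (2 * E) / 2 := by
  have hnR : (6 : ℝ) ≤ n := by exact_mod_cast hn
  have hn0 : (0 : ℝ) < n := by linarith
  have hlow : ∀ m : ℝ, 6 ≤ m → 3 / 2 ≤ Real.log m := by
    intro m hm
    have := le_log_of_pow_le (n := m) (p := 3) (q := 2) (by linarith) (by norm_num)
      (by nlinarith)
    simpa using this
  have hdec : ∀ m : ℝ, 4 ≤ m → m ≤ n → 1 / (n : ℝ) - 2 / n ^ 2 ≤ 1 / m - 2 / m ^ 2 := by
    intro m hm hmn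
    have hm0 : 0 < m := by linarith
    have e : 1 / m - 2 / m ^ 2 - (1 / (n : ℝ) - 2 / n ^ 2) =
        (n - m) * (n * (m - 2) - 2 * m) / (m ^ 2 * n ^ 2) := by field_simp; ring
    have : 0 ≤ (n - m) * (n * (m - 2) - 2 * m) / (m ^ 2 * n ^ 2) := by
      refine div_nonneg (mul_nonneg (by linarith) ?_) (by positivity)
      nlinarith
    linarith
  -- The ranges are n = 6, 7 ≤ n ≤ 10 and n ≥ 11, with E₀ the logarithm of the left end point and
  -- k₁, k₂ decay rates valid throughout the range. The monotonicity `hdec` gives k₂, and the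
  -- largest n of the range, if any, gives k₁.
  rcases Nat.lt_or_ge n 11 with h11 | h11
  · rcases Nat.eq_or_lt_of_le hn with rfl | h7
    · refine traceMajorant_le_of_trapezoid (E₀ := Real.log 6) (k₁ := 5 / 4) (k₂ := 3 / 4)
        (u := 9 / 5) (a₁ := 0.1066) (a₂ := 0.261) (by norm_num) (hlow 6 le_rfl)
        (by exact_mod_cast hE) ?_ (by norm_num) (by norm_num) (by norm_num) (by norm_num) ?_ ?_
        (by norm_num)
      · simpa using log_le_of_pow_le (n := 6) (p := 9) (q := 5) (by norm_num) (by norm_num)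
          (by norm_num)
      · simpa using exp_neg_mul_log_le (n := 6) (c := 0.1066) (p := 5) (q := 4) (by norm_num)
          (by norm_num) (by norm_num) (by norm_num)
      · simpa using exp_neg_mul_log_le (n := 6) (c := 0.261) (p := 3) (q := 4) (by norm_num)
          (by norm_num) (by norm_num) (by norm_num)
    · have h7R : (7 : ℝ) ≤ n := by exact_mod_cast h7
      have h10R : (n : ℝ) ≤ 10 := by exact_mod_cast Nat.le_of_lt_succ h11
      have hd := hdec 7 (by norm_num) h7R
      have hd2 : 2 / 10 ≤ 2 / (n : ℝ) := by gcongr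
      refine traceMajorant_le_of_trapezoid (E₀ := Real.log 7) (k₁ := 11 / 10) (k₂ := 19 / 25)
        (u := 39 / 20) (a₁ := 0.1177) (a₂ := 0.228) (by linarith) (hlow 7 (by norm_num))
        ((Real.log_le_log (by norm_num) h7R).trans hE) ?_ (by linarith) (by linarith)
        (by norm_num) (by norm_num) ?_ ?_ (by norm_num)
      · simpa using log_le_of_pow_le (n := 7) (p := 39) (q := 20) (by norm_num) (by norm_num)
          (by norm_num)
      · simpa using exp_neg_mul_log_le (n := 7) (c := 0.1177) (p := 11) (q := 10) (by norm_num)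
          (by norm_num) (by norm_num) (by norm_num)
      · simpa using exp_neg_mul_log_le (n := 7) (c := 0.228) (p := 19) (q := 25) (by norm_num)
          (by norm_num) (by norm_num) (by norm_num)
  · have h11R : (11 : ℝ) ≤ n := by exact_mod_cast h11
    have hd := hdec 11 (by norm_num) h11R
    have hd2 : 0 ≤ 2 / (n : ℝ) := by positivity
    refine traceMajorant_le_of_trapezoid (E₀ := Real.log 11) (k₁ := 7 / 8) (k₂ := 79 / 100)
      (u := 12 / 5) (a₁ := 0.1228) (a₂ := 0.1506) (by linarith) (hlow 11 (by norm_num))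
      ((Real.log_le_log (by norm_num) h11R).trans hE) ?_ (by linarith) (by linarith)
      (by norm_num) (by norm_num) ?_ ?_ (by norm_num)
    · simpa using log_le_of_pow_le (n := 11) (p := 12) (q := 5) (by norm_num) (by norm_num)
        (by norm_num)
    · simpa using exp_neg_mul_log_le (n := 11) (c := 0.1228) (p := 7) (q := 8) (by norm_num)
        (by norm_num) (by norm_num) (by norm_num)
    · simpa using exp_neg_mul_log_le (n := 11) (c := 0.1506) (p := 79) (q := 100) (by norm_num)
        (by norm_num) (by norm_num) (by norm_num)

/-- A two-exponential estimate, checked at the left end point. -/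
theorem two_exp_le {E E₀ k₁ k₂ P Q a b C : ℝ} (hE : E₀ ≤ E) (hk₁ : 0 ≤ k₁) (hk₂ : k₂ ≤ 2 * k₁)
    (hP : 0 ≤ P) (hQ : 0 ≤ Q) (ha : Real.exp (-k₁ * E₀) ≤ a) (hb : b ≤ Real.exp (-k₂ * E₀))
    (hb0 : 0 ≤ b) (hab : 2 * (Q * b) ≤ P * a) (h : P * a - Q * b ≤ C) :
    P * Real.exp ((2 - k₁) * E) - Q * Real.exp ((2 - k₂) * E) ≤ C * Real.exp (2 * E) := by
  set σ := Real.exp (-k₁ * (E - E₀)) with hσ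
  have hσ0 : 0 < σ := Real.exp_pos _
  have hσ1 : σ ≤ 1 := Real.exp_le_one_iff.2 (by nlinarith)
  have e1 : Real.exp ((2 - k₁) * E) = Real.exp (2 * E) * (Real.exp (-k₁ * E₀) * σ) := by
    rw [hσ, ← Real.exp_add, ← Real.exp_add]; ring_nf
  have e2 : Real.exp (2 * E) * (Real.exp (-k₂ * E₀) * σ ^ 2) ≤ Real.exp ((2 - k₂) * E) := by
    rw [hσ, ← Real.exp_nat_mul, ← Real.exp_add, ← Real.exp_add]
    refine Real.exp_le_exp.2 ?_
    push_cast
    nlinarith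
  have hX := Real.exp_pos (2 * E)
  have h1 : P * (Real.exp (-k₁ * E₀) * σ) ≤ P * (a * σ) := by gcongr
  have h2 : Q * (b * σ ^ 2) ≤ Q * (Real.exp (-k₂ * E₀) * σ ^ 2) := by gcongr
  -- The map σ ↦ Paσ − Qbσ² increases on [0, 1] because 2Qb ≤ Pa, so its maximum is at σ = 1, that
  -- is E = E₀.
  have h3 : P * (a * σ) - Q * (b * σ ^ 2) ≤ P * a - Q * b := by
    have hQb : 0 ≤ Q * b := mul_nonneg hQ hb0
    nlinarith [mul_nonneg (sub_nonneg.2 hσ1) (sub_nonneg.2 hab),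
      mul_nonneg (mul_nonneg (sub_nonneg.2 hσ1) (sub_nonneg.2 hσ1)) hQb]
  calc _ ≤ P * (Real.exp (2 * E) * (Real.exp (-k₁ * E₀) * σ)) -
        Q * (Real.exp (2 * E) * (Real.exp (-k₂ * E₀) * σ ^ 2)) := by
        rw [e1]
        exact sub_le_sub_left (mul_le_mul_of_nonneg_left e2 hQ) _
    _ = (P * (Real.exp (-k₁ * E₀) * σ) - Q * (Real.exp (-k₂ * E₀) * σ ^ 2)) *
        Real.exp (2 * E) := by ring
    _ ≤ C * Real.exp (2 * E) := by
        refine mul_le_mul_of_nonneg_right ?_ hX.le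
        linarith

theorem le_exp_neg_mul_log {n c : ℝ} (hn : 0 < n) {p q : ℕ} (hq : q ≠ 0)
    (h : c ^ q * n ^ p ≤ 1) : c ≤ Real.exp (-(p / q : ℝ) * Real.log n) := by
  have hq' : (q : ℝ) ≠ 0 := by exact_mod_cast hq
  refine le_of_pow_le_pow_left₀ hq (Real.exp_pos _).le ?_
  have e : Real.exp (-(p / q : ℝ) * Real.log n) ^ q = (n ^ p)⁻¹ := by
    rw [← Real.exp_nat_mul, show (q : ℝ) * (-(p / q : ℝ) * Real.log n) = -(p * Real.log n) by
      field_simp, Real.exp_neg, Real.exp_nat_mul, Real.exp_log hn]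
  rw [e]
  rw [← one_div, le_div_iff₀ (by positivity)]
  exact h

theorem traceMajorant_five_le {E : ℝ} (hE : Real.log 5 ≤ E) :
    traceMajorant 5 (9 / 2 * E / 5) ≤ Real.exp (2 * E) / 2 := by
  have h := two_exp_le (P := 25) (Q := 12) (k₁ := 37 / 50) (k₂ := 53 / 40) (a := 0.305) (b := 0.11)
    (C := 13 / 2) hE (by norm_num) (by norm_num) (by norm_num) (by norm_num)
    (by simpa using exp_neg_mul_log_le (n := 5) (c := 0.305) (p := 37) (q := 50) (by norm_num)
          (by norm_num) (by norm_num) (by norm_num))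
    (by simpa using le_exp_neg_mul_log (n := 5) (c := 0.11) (p := 53) (q := 40) (by norm_num)
          (by norm_num) (by norm_num))
    (by norm_num) (by norm_num) (by norm_num)
  have e1 : rateTop 5 * (9 / 2 * E / 5) = (2 - 37 / 50) * E := by unfold rateTop; ring
  have e2 : rateLow 5 * (9 / 2 * E / 5) = (2 - 53 / 40) * E := by unfold rateLow; ring
  rw [traceMajorant, e1, e2]
  linarith

theorem traceMajorant_four_le {E : ℝ} (hE : Real.log 4 ≤ E) :
    traceMajorant 4 (9 / 2 * E / 4) ≤ Real.exp (2 * E) / 2 := by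
  have h := two_exp_le (P := 16) (Q := 6) (k₁ := 47 / 64) (k₂ := 23 / 16) (a := 0.362) (b := 0.135)
    (C := 5) hE (by norm_num) (by norm_num) (by norm_num) (by norm_num)
    (by simpa using exp_neg_mul_log_le (n := 4) (c := 0.362) (p := 47) (q := 64) (by norm_num)
          (by norm_num) (by norm_num) (by norm_num))
    (by simpa using le_exp_neg_mul_log (n := 4) (c := 0.135) (p := 23) (q := 16) (by norm_num)
          (by norm_num) (by norm_num))
    (by norm_num) (by norm_num) (by norm_num)
  have e1 : rateTop 4 * (9 / 2 * E / 4) = (2 - 47 / 64) * E := by unfold rateTop; ring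
  have e2 : rateLow 4 * (9 / 2 * E / 4) = (2 - 23 / 16) * E := by unfold rateLow; ring
  rw [traceMajorant, e1, e2]
  linarith

/-- Bernoulli's inequality gives the tangent line of x ↦ x^(1/k) at c^k, evaluated at x = exp E. -/
theorem exp_le_of_pow_eq {E c : ℝ} {k : ℕ} (hk : k ≠ 0) (hc : 0 < c) :
    Real.exp (E / k) ≤ c + (Real.exp E / c ^ k - 1) * c / k := by
  have hk' : (0 : ℝ) < k := by positivity
  have hp := Real.exp_pos (E / k)
  have e : Real.exp (E / k) ^ k = Real.exp E := by
    rw [← Real.exp_nat_mul]; congr 1; field_simp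
  have hb := one_add_mul_le_pow (a := Real.exp (E / k) / c - 1)
    (by have : 0 ≤ Real.exp (E / k) / c := by positivity
        linarith) k
  rw [add_sub_cancel, div_pow, e] at hb
  have h1 : (k : ℝ) * (Real.exp (E / k) / c - 1) ≤ Real.exp E / c ^ k - 1 := by linarith
  have h2 : Real.exp (E / k) / c - 1 ≤ (Real.exp E / c ^ k - 1) / k := by
    rw [le_div_iff₀ hk']; linarith
  have h3 : Real.exp (E / k) = c + (Real.exp (E / k) / c - 1) * c := by field_simp; ring
  rw [h3, mul_div_right_comm]
  gcongr

/-- For n = 3, as for n = 2, the bound exp(2E)/2 alone fails at E = log n, so the −1 terms in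
Markov's inequality are kept. The tangent points 1.3 ≈ 3^(1/4) and, for n = 2, 1.09 ≈ 2^(1/8) reduce
the claim to a polynomial in exp E. -/
theorem traceMajorant_three_le {E : ℝ} (hE : Real.log 3 ≤ E) :
    traceMajorant 3 (9 / 2 * E / 3) ≤ Real.exp (2 * E) / 2 + 1 - Real.exp (-E) := by
  have hx : 3 ≤ Real.exp E := (Real.log_le_iff_le_exp (by norm_num)).1 hE
  have h1 := exp_le_of_pow_eq (E := E) (c := 1.3) (k := 4) (by norm_num) (by norm_num)
  have h2 : 3 / 2 ≤ Real.exp (3 / 8 * E) := by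
    refine le_of_pow_le_pow_left₀ (n := 8) (by norm_num) (Real.exp_pos _).le ?_
    rw [← Real.exp_nat_mul, show ((8 : ℕ) : ℝ) * (3 / 8 * E) = (3 : ℕ) * E by push_cast; ring,
      Real.exp_nat_mul]
    calc ((3 : ℝ) / 2) ^ 8 ≤ 3 ^ 3 := by norm_num
      _ ≤ _ := by gcongr
  have h3 : Real.exp (-E) ≤ 1 / 3 := by
    rw [Real.exp_neg, ← one_div]; gcongr
  have e1 : rateTop 3 * (9 / 2 * E / 3) = E + E / 4 := by unfold rateTop; ring
  have e2 : rateLow 3 * (9 / 2 * E / 3) = 3 / 8 * E := by unfold rateLow; ring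
  have e3 : Real.exp (2 * E) = Real.exp E ^ 2 := by
    rw [← Real.exp_nat_mul]; norm_num
  rw [traceMajorant, e1, e2, Real.exp_add, e3]
  norm_num at h1 ⊢
  set x := Real.exp E
  set a := Real.exp (E / 4)
  have h4 : x * a ≤ x * (13 / 10 + (x / (28561 / 10000) - 1) * (13 / 10) / 4) := by gcongr
  rw [div_le_iff₀ (by norm_num)]
  nlinarith [mul_nonneg (sub_nonneg.2 hx) (sub_nonneg.2 hx)]

theorem traceMajorant_two_le {E : ℝ} (hE : Real.log 2 ≤ E) :
    traceMajorant 2 (9 / 2 * E / 2) ≤ Real.exp (2 * E) / 2 + 1 - Real.exp (-E) := by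
  have hx : 2 ≤ Real.exp E := (Real.log_le_iff_le_exp (by norm_num)).1 hE
  have h1 := exp_le_of_pow_eq (E := E) (c := 1.09) (k := 8) (by norm_num) (by norm_num)
  have h3 : Real.exp (-E) ≤ 1 / 2 := by
    rw [Real.exp_neg, ← one_div]; gcongr
  have e1 : rateTop 2 * (9 / 2 * E / 2) = E + E / 8 := by unfold rateTop; ring
  have e3 : Real.exp (2 * E) = Real.exp E ^ 2 := by
    rw [← Real.exp_nat_mul]; norm_num
  rw [traceMajorant, e1, Real.exp_add, e3]
  norm_num at h1 ⊢
  set x := Real.exp E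
  set a := Real.exp (E / 8)
  have h4 := mul_le_mul_of_nonneg_left h1 (by linarith : 0 ≤ x)
  nlinarith [mul_nonneg (sub_nonneg.2 hx) (sub_nonneg.2 hx)]

theorem traceMajorant_sub_one_le {n : ℕ} (hn : 2 ≤ n) {E : ℝ} (hE : Real.log n ≤ E) :
    traceMajorant n (9 / 2 * E / n) - 1 ≤ Real.exp (-E) * (Real.cosh (3 * E) - 1) := by
  have hnR : (2 : ℝ) ≤ n := by exact_mod_cast hn
  have hE0 : 0 ≤ E := (Real.log_nonneg (by linarith)).trans hE
  have hle1 : Real.exp (-E) ≤ 1 := Real.exp_le_one_iff.2 (by linarith)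
  have hmain : traceMajorant n (9 / 2 * E / n) ≤ Real.exp (2 * E) / 2 + 1 - Real.exp (-E) := by
    rcases Nat.lt_or_ge n 6 with h6 | h6
    · interval_cases n
      · exact traceMajorant_two_le (by exact_mod_cast hE)
      · exact traceMajorant_three_le (by exact_mod_cast hE)
      · have := traceMajorant_four_le (E := E) (by exact_mod_cast hE)
        push_cast
        linarith
      · have := traceMajorant_five_le (E := E) (by exact_mod_cast hE)
        push_cast
        linarith
    · have := traceMajorant_le_of_six_le h6 hE
      linarith
  have e : Real.exp (-E) * Real.exp (3 * E) = Real.exp (2 * E) := by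
    rw [← Real.exp_add]; ring_nf
  have hpos : 0 < Real.exp (-E) * Real.exp (-(3 * E)) := by positivity
  rw [Real.cosh_eq]
  linarith

/-- The rate n/4 lies between the two mode rates and the slower mode is subtracted, so advancing the
time by b gains at least exp(nb/4). This absorbs the third-order factor into a time shift. -/
theorem exp_mul_traceMajorant_le {n β b : ℝ} (hn : 2 ≤ n) (hb : 0 ≤ b) :
    Real.exp (n * b / 4) * traceMajorant n β ≤ traceMajorant n (β + b) := by
  have h1 : 0 < 3 * n - 2 := by linarith
  have e1 : Real.exp (rateTop n * (β + b)) = Real.exp (rateTop n * β) * Real.exp (rateTop n * b) := by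
    rw [← Real.exp_add]; ring_nf
  have e2 : Real.exp (rateLow n * (β + b)) = Real.exp (rateLow n * β) * Real.exp (rateLow n * b) := by
    rw [← Real.exp_add]; ring_nf
  have hT : Real.exp (n * b / 4) ≤ Real.exp (rateTop n * b) := by
    refine Real.exp_le_exp.2 ?_
    have : 1 / (2 * n) ≤ 1 / 4 := by rw [div_le_div_iff₀ (by linarith) (by norm_num)]; linarith
    have : n / 4 ≤ rateTop n := by unfold rateTop; linarith
    nlinarith
  have hL : Real.exp (rateLow n * b) ≤ Real.exp (n * b / 4) := by
    refine Real.exp_le_exp.2 ?_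
    unfold rateLow; nlinarith
  have h4 : 0 ≤ (n - 1) * (n - 2) := mul_nonneg (by linarith) (by linarith)
  rw [traceMajorant, traceMajorant, e1, e2, ← mul_div_assoc]
  refine div_le_div_of_nonneg_right ?_ h1.le
  have h5 := mul_le_mul_of_nonneg_left hT
    (mul_nonneg (sq_nonneg n) (Real.exp_pos (rateTop n * β)).le)
  have h6 := mul_le_mul_of_nonneg_left hL (mul_nonneg h4 (Real.exp_pos (rateLow n * β)).le)
  linarith

end MajorantEstimates

end BSBM

namespace BSBM

open MeasureTheory ProbabilityTheory Matrix

/-! ### From the random matrix to finite Bernoulli sums. -/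

section Transfer

variable {Ω : Type*} [MeasurableSpace Ω] {μ : Measure Ω} {n₁ n₂ : ℕ} {δ p : ℝ}
  {η₁ : Fin n₁ → ℤˣ} {η₂ : Fin n₂ → ℤˣ} {A : Ω → Matrix (Fin n₁) (Fin n₂) ℝ}

theorem IsBSBM.integral_eq (hA : IsBSBM μ δ p η₁ η₂ A) (i : Fin n₁) (j : Fin n₂) :
    ∫ ω, A ω i j ∂μ = edgeProb δ p (η₁ i) (η₂ j) := by
  obtain ⟨q, hq, hl⟩ := hA.law i j
  rw [hl.integral_eq, integral_bernoulliMeasure, ← hq]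
  simp

theorem IsBSBM.measureReal_entry_eq (hA : IsBSBM μ δ p η₁ η₂ A) (i : Fin n₁) (j : Fin n₂)
    (b : Bool) :
    μ.real {ω | A ω i j = if b then 1 else 0} = bernWeight (edgeProb δ p (η₁ i) (η₂ j)) b := by
  obtain ⟨q, hq, hl⟩ := hA.law i j
  rw [hl.measureReal_eq (p := fun x => x = if b then 1 else 0) (measurableSet_singleton _), ← hq]
  have hset : ∀ y : ℝ, {x : ℝ | x = y} = {y} := fun _ => rfl
  cases b <;> simp [bernWeight, hset]

theorem IsBSBM.ae_entry (hA : IsBSBM μ δ p η₁ η₂ A) :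
    ∀ᵐ ω ∂μ, ∀ i j, A ω i j = 1 ∨ A ω i j = 0 := by
  refine ae_all_iff.2 fun i => ae_all_iff.2 fun j => ?_
  obtain ⟨q, -, hl⟩ := hA.law i j
  have hs : MeasurableSet ({1, 0} : Set ℝ) := (Set.toFinite _).measurableSet
  have h : (bernoulliMeasure (1 : ℝ) 0 q) {1, 0}ᶜ = 0 := by
    rw [bernoulliMeasure_apply_of_notMem_of_notMem q hs.compl] <;> simp
  have h' : μ {ω | A ω i j ∈ ({1, 0} : Set ℝ)ᶜ} = 0 := by
    rw [hl.measure_eq (p := fun x => x ∈ ({1, 0} : Set ℝ)ᶜ) hs.compl]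
    exact h
  filter_upwards [measure_eq_zero_iff_ae_notMem.1 h'] with ω hω
  simpa [or_iff_not_imp_left] using hω

theorem IsBSBM.measureReal_eq_outcome (hA : IsBSBM μ δ p η₁ η₂ A) (c : Fin n₂ → Fin n₁ → Bool) :
    μ.real {ω | ∀ i j, A ω i j = if c j i then 1 else 0} =
      ∏ j, ∏ i, bernWeight (edgeProb δ p (η₁ i) (η₂ j)) (c j i) := by
  have h := hA.indep.measure_inter_preimage_eq_mul Finset.univ
    (sets := fun ij => {if c ij.2 ij.1 then (1 : ℝ) else 0}) fun _ _ => measurableSet_singleton _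
  have hset : {ω | ∀ i j, A ω i j = if c j i then 1 else 0} =
      ⋂ ij ∈ (Finset.univ : Finset (Fin n₁ × Fin n₂)), (fun ω => A ω ij.1 ij.2) ⁻¹'
        {if c ij.2 ij.1 then (1 : ℝ) else 0} := by
    ext ω
    simp
  rw [hset, measureReal_def, h, ENNReal.toReal_prod, Fintype.prod_prod_type_right]
  refine Finset.prod_congr rfl fun j _ => Finset.prod_congr rfl fun i _ => ?_
  rw [← hA.measureReal_entry_eq i j (c j i)]
  rfl

theorem IsBSBM.sum_hollow_noise (hA : IsBSBM μ δ p η₁ η₂ A) {c : Fin n₂ → Fin n₁ → Bool} {ω : Ω}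
    (hω : ∀ i j, A ω i j = if c j i then 1 else 0) :
    ∑ j, hollow (vecMulVec ((noise μ A ω).col j) ((noise μ A ω).col j)) =
      gramSum 1 (fun j i => edgeProb δ p (η₁ i) (η₂ j)) c := by
  refine Finset.sum_congr rfl fun j _ => ?_
  have hcol : (noise μ A ω).col j = fun i => bernDev (edgeProb δ p (η₁ i) (η₂ j)) (c j i) := by
    ext i
    simp [noise, bernDev, hω, hA.integral_eq]
  rw [colMatrix, one_smul, hcol]

open Classical in
theorem IsBSBM.measureReal_le_multiExp [IsProbabilityMeasure μ] (hA : IsBSBM μ δ p η₁ η₂ A)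
    (t : ℝ) :
    μ.real {ω | t ≤ spectralNorm (∑ j,
        hollow (vecMulVec ((noise μ A ω).col j) ((noise μ A ω).col j)))} ≤
      multiExp (fun j i => edgeProb δ p (η₁ i) (η₂ j))
        fun c => if t ≤ spectralNorm (gramSum 1 (fun j i => edgeProb δ p (η₁ i) (η₂ j)) c)
          then 1 else 0 := by
  set Q : Fin n₂ → Fin n₁ → ℝ := fun j i => edgeProb δ p (η₁ i) (η₂ j) with hQ
  set B : Finset (Fin n₂ → Fin n₁ → Bool) :=
    Finset.univ.filter fun c => t ≤ spectralNorm (gramSum 1 Q c) with hB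
  -- Almost surely all entries are 0 or 1, so the event lies, up to a null set, in a finite union of
  -- outcome events whose probabilities are products.
  have hsub : {ω | t ≤ spectralNorm (∑ j,
        hollow (vecMulVec ((noise μ A ω).col j) ((noise μ A ω).col j)))} ≤ᵐ[μ]
      (⋃ c ∈ B, {ω | ∀ i j, A ω i j = if c j i then 1 else 0} : Set Ω) := by
    filter_upwards [hA.ae_entry] with ω hω hbad
    have hc : ∀ i j, A ω i j = if (fun j i => decide (A ω i j = 1) : Fin n₂ → Fin n₁ → Bool) j i
        then 1 else 0 := by
      intro i j
      rcases hω i j with h | h <;> simp [h]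
    have hbad' : t ≤ spectralNorm (∑ j,
        hollow (vecMulVec ((noise μ A ω).col j) ((noise μ A ω).col j))) := hbad
    rw [hA.sum_hollow_noise hc] at hbad'
    exact Set.mem_biUnion (x := fun j i => decide (A ω i j = 1)) (by simpa [hB] using hbad') hc
  have hle : μ.real {ω | t ≤ spectralNorm (∑ j,
        hollow (vecMulVec ((noise μ A ω).col j) ((noise μ A ω).col j)))} ≤
      μ.real (⋃ c ∈ B, {ω | ∀ i j, A ω i j = if c j i then 1 else 0} : Set Ω) :=
    ENNReal.toReal_mono (measure_ne_top _ _) (measure_mono_ae hsub)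
  refine hle.trans ((measureReal_biUnion_finset_le _ _).trans (le_of_eq ?_))
  simp only [multiExp, mul_ite, mul_one, mul_zero]
  rw [← Finset.sum_filter]
  exact Finset.sum_congr rfl fun c _ => hA.measureReal_eq_outcome c

end Transfer

/-! ### Choice of the parameter and the tail bound. -/

section Tail

open Classical in
/-- The matrix Bernstein bound for independent Bernoulli variables. -/
theorem multiExp_indicator_le {n N : ℕ} (hn : 2 ≤ n) {v : ℝ} (hv0 : 0 < v)
    (hN : 0 < N) (Q : Fin N → Fin n → ℝ) (h0 : ∀ j i, 0 ≤ Q j i) (h1 : ∀ j i, Q j i ≤ 1)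
    (hv : ∀ j i, Q j i * (1 - Q j i) ≤ v) {t : ℝ} (ht : 0 < t)
    {E : ℝ} (hE : E = t ^ 2 / (2 * (n * N * v ^ 2 + 3 * (1 + n * v) * t))) (hlog : Real.log n ≤ E) :
    multiExp Q (fun c => if t ≤ spectralNorm (gramSum 1 Q c) then 1 else 0) ≤
      n * Real.exp (-E) := by
  have hnR : (2 : ℝ) ≤ n := by exact_mod_cast hn
  have hn0 : (0 : ℝ) < n := by linarith
  have hNR : (0 : ℝ) < N := by exact_mod_cast hN
  set S : ℝ := n * N * v ^ 2 with hS
  set u : ℝ := 1 + n * v with hu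
  have hS0 : 0 < S := by positivity
  have hu0 : 0 < u := by positivity
  set D : ℝ := S + 3 * u * t with hD
  have hD0 : 0 < D := by positivity
  have hE0 : 0 < E := by rw [hE]; positivity
  -- The factor 3/2 gives θt = 3E. With z the share of the variance term in D, one has θu = (1−z)/2
  -- ≤ 1/2, as the third-order bound requires, and κ = (1−z)/(1+z).
  set θ : ℝ := 3 / 2 * t / D with hθ
  set z : ℝ := S / D with hz
  have hz0 : 0 < z := by positivity
  have hz1 : z ≤ 1 := by rw [hz, div_le_one hD0, hD]; nlinarith [mul_pos hu0 ht]
  have hy : θ * u = (1 - z) / 2 := by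
    rw [hθ, hz]; field_simp; rw [hD]; ring
  have hθt : θ * t = 3 * E := by rw [hθ, hE]; field_simp
  have hgz : n * (N * (θ ^ 2 * v ^ 2)) = 9 / 2 * E * z := by
    rw [hθ, hE, hz, hS]; field_simp; norm_num
  have h := multiExp_indicator_mul_le hv0.le hn (θ := θ) (κ := (1 - z) / (1 + z)) (by positivity)
    (by rw [← hu, hy]; linarith)
    (by rw [← hu, hy, show 1 - (1 - z) / 2 = (1 + z) / 2 by ring, div_div_div_cancel_right₀ two_ne_zero]) Q h0 h1 hv ht
  rw [hθt] at h
  have hb0 : 0 ≤ 9 / 2 * (E / n) * (1 - z) := mul_nonneg (by positivity) (by linarith)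
  -- The time used is z times the target (9/2)E/n. The unused share 1 − z covers the third-order
  -- factor because z/(1+z) ≤ 1/2.
  have hβ : N * (θ ^ 2 * v ^ 2) + 9 / 2 * (E / n) * (1 - z) = 9 / 2 * E / n := by
    field_simp
    linarith [hgz]
  have hm : Real.exp (N * (θ ^ 2 * v ^ 2 * n * ((1 - z) / (1 + z)) / 2)) *
      traceMajorant n (N * (θ ^ 2 * v ^ 2)) ≤ traceMajorant n (9 / 2 * E / n) := by
    rw [← hβ]
    refine le_trans (mul_le_mul_of_nonneg_right (Real.exp_le_exp.2 ?_)
      (traceMajorant_nonneg hnR (by positivity))) (exp_mul_traceMajorant_le hnR hb0)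
    have e1 : N * (θ ^ 2 * v ^ 2 * n * ((1 - z) / (1 + z)) / 2) =
        9 / 4 * E * (1 - z) * (z / (1 + z)) := by
      have : N * (θ ^ 2 * v ^ 2 * n * ((1 - z) / (1 + z)) / 2) =
        n * (N * (θ ^ 2 * v ^ 2)) * ((1 - z) / (1 + z)) / 2 := by ring
      rw [this, hgz]; ring
    have e2 : n * (9 / 2 * (E / n) * (1 - z)) / 4 = 9 / 4 * E * (1 - z) * (1 / 2) := by
      field_simp
    rw [e1, e2]
    refine mul_le_mul_of_nonneg_left ?_ (mul_nonneg (by positivity) (by linarith))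
    rw [div_le_div_iff₀ (by linarith) two_pos]
    linarith
  have hc : 0 < Real.cosh (3 * E) - 1 := sub_pos.2 (Real.one_lt_cosh.2 (by positivity))
  refine le_of_mul_le_mul_right (h.trans ?_) hc
  rw [mul_assoc (n : ℝ) (Real.exp _)]
  refine mul_le_mul_of_nonneg_left ?_ hn0.le
  linarith [traceMajorant_sub_one_le hn hlog]

theorem edgeProb_le {δ p : ℝ} (hδ : δ ∈ Set.Ioo (0 : ℝ) 2) (hp : 0 ≤ p) (s s' : ℤˣ) :
    edgeProb δ p s s' ≤ 2 * p := by
  unfold edgeProb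
  split_ifs
  · nlinarith [hδ.2]
  · nlinarith [hδ.1]

end Tail

end BSBM

theorem theorem4 {Ω : Type*} [MeasurableSpace Ω] (μ : MeasureTheory.Measure Ω)
    [MeasureTheory.IsProbabilityMeasure μ] (n₁ n₂ : ℕ) (hn₁ : 2 ≤ n₁) (hn : n₁ ≤ n₂)
    (δ p : ℝ) (hδ : δ ∈ Set.Ioo (0 : ℝ) 2) (hp : p ∈ Set.Ioo (0 : ℝ) (1 / 2))
    (η₁ : Fin n₁ → ℤˣ) (η₂ : Fin n₂ → ℤˣ) (A : Ω → Matrix (Fin n₁) (Fin n₂) ℝ)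
    (hA : BSBM.IsBSBM μ δ p η₁ η₂ A) (t : ℝ) (ht : 0 ≤ t) :
    μ.real {ω | t ≤ BSBM.spectralNorm (∑ j : Fin n₂,
        BSBM.hollow (Matrix.vecMulVec ((BSBM.noise μ A ω).col j) ((BSBM.noise μ A ω).col j)))} ≤
      (n₁ : ℝ) * Real.exp
        (-(t ^ 2 / (8 * (n₁ : ℝ) * (n₂ : ℝ) * p ^ 2 + 6 * (1 + 2 * (n₁ : ℝ) * p) * t))) := by
  have hn0 : (0 : ℝ) < n₁ := by exact_mod_cast (by omega : 0 < n₁)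
  set E : ℝ := t ^ 2 / (8 * (n₁ : ℝ) * (n₂ : ℝ) * p ^ 2 + 6 * (1 + 2 * (n₁ : ℝ) * p) * t) with hE
  rcases lt_or_ge E (Real.log n₁) with hlog | hlog
  -- When E < log n₁ the right-hand side exceeds 1.
  · refine MeasureTheory.measureReal_le_one.trans ?_
    rw [Real.exp_neg, ← div_eq_mul_inv, one_le_div (Real.exp_pos _)]
    exact ((Real.lt_log_iff_exp_lt hn0).1 hlog).le
  have ht0 : 0 < t := by
    refine lt_of_le_of_ne ht fun h => ?_
    have : 0 < Real.log n₁ := Real.log_pos (by exact_mod_cast (by omega : 1 < n₁))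
    rw [hE, ← h] at hlog
    norm_num at hlog
    linarith
  have hq : ∀ j i, 0 ≤ BSBM.edgeProb δ p (η₁ i) (η₂ j) ∧ BSBM.edgeProb δ p (η₁ i) (η₂ j) ≤ 1 := by
    intro j i
    obtain ⟨q, hq, -⟩ := hA.law i j
    rw [← hq]
    exact ⟨q.2.1, q.2.2⟩
  refine (hA.measureReal_le_multiExp t).trans ?_
  -- The variance bound is q(1−q) ≤ q ≤ 2p, and v = 2p reproduces the constants 8 and 6 of the
  -- denominator.
  refine BSBM.multiExp_indicator_le hn₁ (v := 2 * p) (by linarith [hp.1]) (by omega) _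
    (fun j i => (hq j i).1) (fun j i => (hq j i).2) (fun j i => ?_) ht0 ?_ hlog
  · have := BSBM.edgeProb_le hδ hp.1.le (η₁ i) (η₂ j)
    nlinarith [hq j i]
  · rw [hE]
    congr 1
    ring
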